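/- Let $A\in\mathbb R^{n\times n}$, $B\in\mathbb R^{n\times m}$, $C\in\mathbb R^{p\times n}$, $D\in\mathbb R^{p\times m}$ and $\hat A\in\mathbb R^{r\times r}$, $\hat B\in\mathbb R^{r\times m}$, $\hat C\in\mathbb R^{p\times r}$, $\hat D\in\mathbb R^{p\times m}$, where $A$ and $\hat A$ are Hurwitz (all eigenvalues have negative real part), and let $0<\omega<\infty$. Put $G(i\nu)=C(i\nu I-A)^{-1}B+D$, $\hat G(i\nu)=\hat C(i\nu I-\hat A)^{-1}\hat B+\hat D$, $E=G-\hat G$, and $$\|G-\hat G\|_{H_2,\omega}^2=\frac1{2\pi}\operatorname{tr}\int_{-\omega}^{\omega}E(i\nu)E(i\nu)^{H}\,d\nu .$$ Let $\ln$ be the principal matrix logarithm, $L(R,\cdot)$ its Fréchet derivative at $R$, and $$S_\omega=\operatorname{Re}\Big[\tfrac{i}{\pi}\ln(-A-i\omega I)\Big],\qquad \hat S_\omega=\operatorname{Re}\Big[\tfrac{i}{\pi}\ln(-\hat A-i\omega I)\Big].$$ Then the logarithms exist, $\ln$ is differentiable at $-\hat A-i\omega I$, and each of the equations $$\begin{aligned}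 AX_\omega+X_\omega\hat A^T+S_\omega B\hat B^T+B\hat B^T\hat S_\omega^T&=0, & \hat A\hat P_\omega+\hat P_\omega\hat A^T+\hat S_\omega\hat B\hat B^T+\hat B\hat B^T\hat S_\omega^T&=0,\\ A^TY_\omega+Y_\omega\hat A-S_\omega^TC^T\hat C-C^T\hat C\hat S_\omega&=0, & \hat A^T\hat Q_\omega+\hat Q_\omega\hat A+\hat S_\omega^T\hat C^T\hat C+\hat C^T\hat C\hat S_\omega&=0,\\ AX+X\hat A^T+B\hat B^T&=0, & \hat A\hat P+\hat P\hat A^T+\hat B\hat B^T&=0 \end{aligned}$$ has exactly one real solution. Let $S_{\hat A},S_{\hat B},S_{\hat C},S_{\hat D}$ be matrices with entries in $\{0,1\}$, of the sizes of $\hat A,\hat B,\hat C,\hat D$; the entry $1$ marks a free variable and $0$ an entry that is kept fixed. Let $\odot$ be the elementwise product, and $$V=\hat C^T\hat C\hat P-\hat C^TCX-\hat C^T(D-\hat D)\hat B^T,\qquad W=\operatorname{Re}\Big[\tfrac{i}{\pi}L\big(-\hat A-i\omega I,\,V^T\big)\Big]^T .$$ Then the matrices of partial derivatives of the cost with respect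 to the free entries (with $0$ at the fixed entries) are $$\begin{aligned} \frac{\partial\|G-\hat G\|^2_{H_2,\omega}}{\partial\hat A}&=2\big(Y_\omega^TX+\hat Q_\omega\hat P\big)\odot S_{\hat A}-2W\odot S_{\hat A},\\ \frac{\partial\|G-\hat G\|^2_{H_2,\omega}}{\partial\hat B}&=2\big(\hat Q_\omega\hat B+Y_\omega^TB-\hat S_\omega^T\hat C^T(D-\hat D)\big)\odot S_{\hat B},\\ \frac{\partial\|G-\hat G\|^2_{H_2,\omega}}{\partial\hat C}&=2\big(\hat C\hat P_\omega-CX_\omega-(D-\hat D)\hat B^T\hat S_\omega^T\big)\odot S_{\hat C},\\ \frac{\partial\|G-\hat G\|^2_{H_2,\omega}}{\partial\hat D}&=-2\Big(CS_\omega B+\tfrac{\omega}{2\pi}D-\hat C\hat S_\omega\hat B-\tfrac{\omega}{2\pi}\hat D+\tfrac{\omega}{2\pi}(D-\hat D)\Big)\odot S_{\hat D}. \end{aligned}$$ Moreover the cost is jointly (Fréchet) differentiable in the free entries of $(\hat A,\hat B,\hat C,\hat D)$, with this gradient. -/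

import Mathlib

open scoped Matrix

noncomputable section

/-- The complexification of a real matrix. -/
def toComplexMatrix {a b : ℕ} (M : Matrix (Fin a) (Fin b) ℝ) : Matrix (Fin a) (Fin b) ℂ :=
  M.map Complex.ofReal

/-- A real square matrix is Hurwitz when all its complex eigenvalues have negative real part. -/
def IsHurwitz {n : ℕ} (A : Matrix (Fin n) (Fin n) ℝ) : Prop :=
  ∀ z ∈ spectrum ℂ (toComplexMatrix A), z.re < 0

/-- The value `C (iν I - A)⁻¹ B + D` at `iν` of the transfer function of the system
`x' = A x + B u`, `y = C x + D u`. -/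
def transferFunction {n m p : ℕ} (A : Matrix (Fin n) (Fin n) ℝ) (B : Matrix (Fin n) (Fin m) ℝ)
    (C : Matrix (Fin p) (Fin n) ℝ) (D : Matrix (Fin p) (Fin m) ℝ) (ν : ℝ) :
    Matrix (Fin p) (Fin m) ℂ :=
  toComplexMatrix C
      * ((Complex.I * (ν : ℂ)) • (1 : Matrix (Fin n) (Fin n) ℂ) - toComplexMatrix A)⁻¹
      * toComplexMatrix B
    + toComplexMatrix D

/-- The cost `‖G - Ĝ‖²_{H2,ω} = (1/2π) ∫_{-ω}^{ω} tr (E(iν) E(iν)ᴴ) dν` with `E = G - Ĝ`.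
The trace in the integrand is a nonnegative real number, read off by `Complex.re`. -/
def errorCost {n r m p : ℕ} (ω : ℝ)
    (A : Matrix (Fin n) (Fin n) ℝ) (B : Matrix (Fin n) (Fin m) ℝ)
    (C : Matrix (Fin p) (Fin n) ℝ) (D : Matrix (Fin p) (Fin m) ℝ)
    (A' : Matrix (Fin r) (Fin r) ℝ) (B' : Matrix (Fin r) (Fin m) ℝ)
    (C' : Matrix (Fin p) (Fin r) ℝ) (D' : Matrix (Fin p) (Fin m) ℝ) : ℝ :=
  1 / (2 * Real.pi) * ∫ ν in (-ω)..ω,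
    (((transferFunction A B C D ν - transferFunction A' B' C' D' ν)
      * (transferFunction A B C D ν - transferFunction A' B' C' D' ν)ᴴ).trace).re

/-- `X` is a principal logarithm of `R`: `exp X = R`, and the eigenvalues of `X` lie in the strip
`-π < Im z < π`. -/
def IsPrincipalLog {n : ℕ} (R X : Matrix (Fin n) (Fin n) ℂ) : Prop :=
  NormedSpace.exp X = R ∧ ∀ z ∈ spectrum ℂ X, -Real.pi < z.im ∧ z.im < Real.pi

open Classical in
/-- The principal matrix logarithm, with value `0` where there is none (that is, unless `R` is
invertible and has no eigenvalue on the negative real axis). -/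
def matrixLog {n : ℕ} (R : Matrix (Fin n) (Fin n) ℂ) : Matrix (Fin n) (Fin n) ℂ :=
  if h : ∃ X, IsPrincipalLog R X then h.choose else 0

/-- `L(R, E)`: the Fréchet derivative of the matrix logarithm at `R` in the direction `E`. -/
def logFrechet {n : ℕ} (R E : Matrix (Fin n) (Fin n) ℂ) : Matrix (Fin n) (Fin n) ℂ :=
  fderiv ℂ (matrixLog (n := n)) R E

/-- The matrix `-A - iω I`. -/
def negShift {n : ℕ} (ω : ℝ) (A : Matrix (Fin n) (Fin n) ℝ) : Matrix (Fin n) (Fin n) ℂ :=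
  -toComplexMatrix A - (Complex.I * (ω : ℂ)) • (1 : Matrix (Fin n) (Fin n) ℂ)

/-- `S_ω = Re [(i/π) ln(-A - iω I)]`. -/
def freqS {n : ℕ} (ω : ℝ) (A : Matrix (Fin n) (Fin n) ℝ) : Matrix (Fin n) (Fin n) ℝ :=
  ((Complex.I / (Real.pi : ℂ)) • matrixLog (negShift ω A)).map Complex.re

/-- `X` solves the Sylvester equation `F X + X G + H = 0`. -/
def SolvesSylvester {a b : ℕ} (F : Matrix (Fin a) (Fin a) ℝ) (G : Matrix (Fin b) (Fin b) ℝ)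
    (H X : Matrix (Fin a) (Fin b) ℝ) : Prop :=
  F * X + X * G + H = 0

/-- `V = Ĉᵀ Ĉ P̂ - Ĉᵀ C X - Ĉᵀ (D - D̂) B̂ᵀ`. -/
def gradV {n r m p : ℕ}
    (C : Matrix (Fin p) (Fin n) ℝ) (D : Matrix (Fin p) (Fin m) ℝ)
    (B' : Matrix (Fin r) (Fin m) ℝ) (C' : Matrix (Fin p) (Fin r) ℝ) (D' : Matrix (Fin p) (Fin m) ℝ)
    (X : Matrix (Fin n) (Fin r) ℝ) (P' : Matrix (Fin r) (Fin r) ℝ) : Matrix (Fin r) (Fin r) ℝ :=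
  C'ᵀ * C' * P' - C'ᵀ * C * X - C'ᵀ * (D - D') * B'ᵀ

/-- `W = (Re [(i/π) L(-Â - iω I, Vᵀ)])ᵀ`. -/
def gradW {r : ℕ} (ω : ℝ) (A' V : Matrix (Fin r) (Fin r) ℝ) : Matrix (Fin r) (Fin r) ℝ :=
  (((Complex.I / (Real.pi : ℂ)) • logFrechet (negShift ω A') (toComplexMatrix Vᵀ)).map
    Complex.re)ᵀ

/-- A structure matrix: an entry `1` marks a free variable, an entry `0` a fixed one. -/
def IsStructureMatrix {a b : ℕ} (S : Matrix (Fin a) (Fin b) ℝ) : Prop :=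
  ∀ i j, S i j = 0 ∨ S i j = 1

/-- `G` is the matrix of elementwise partial derivatives of `f` at `M` under the structure `S`:
the `(i, j)` entry of `M` is varied if it is free, and kept fixed otherwise. -/
def HasStructuredPartials {a b : ℕ} (f : Matrix (Fin a) (Fin b) ℝ → ℝ)
    (S M G : Matrix (Fin a) (Fin b) ℝ) : Prop :=
  ∀ i j, HasDerivAt (fun t : ℝ => f (M + S ⊙ Matrix.single i j t)) (G i j) 0

end

/-! Everything is reduced to averages over the frequency band. Write R(ν) = (iνI - A)⁻¹ and R'(ν)
for the reduced system, and let `bandMean` be the real part of (1/2π)∫ over [-ω, ω]. Three facts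
carry the proof.

The matrix S_ω is the band mean of R (`freqS_eq_bandMean`). Along iνI - A the logarithm has
ν-derivative iR(ν), and its values at ω and -ω are complex conjugates, so the fundamental theorem of
calculus leaves only an imaginary part at the endpoint. To justify this, the principal logarithm is
built as ∫₀¹ (R - 1)(1 + t(R - 1))⁻¹ dt, which is visibly differentiable. It is a logarithm with
spectrum in the open strip, and such a logarithm is unique. Differentiating the same identity in A
turns the Fréchet derivative of the logarithm into minus the band mean of R N R
(`re_logFrechet_eq_neg_bandMean`).

The solutions of the band-limited Sylvester equations are band means of R H R'ᴴ or Rᴴ H R', since A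
R = iνR - 1 makes the factors iν cancel. The Sylvester operator of two Hurwitz matrices is
injective, because two commuting maps have a common eigenvector in any nonzero invariant subspace.
Hence solutions exist and are unique.

The cost is differentiated under the integral: its differential is -2 tr of the band mean of (dĜ)Eᴴ,
and cyclicity of the trace pairs each of the four directions with one band mean. Those for B̂, Ĉ, D̂
are immediate combinations of the above. The one for Â contains R' B̂ Eᴴ Ĉ R' with three resolvents
in a row; the ordinary Sylvester solutions X and P̂ split such a product into a sum, one half giving
Y_ω and Q̂_ω, the other combining with D - D̂ into the logarithm term W. The masks enter at the end
through the chain rule. -/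

section

/-! ### Differentiation under an integral over a compact interval -/

open Set Filter Topology MeasureTheory
open scoped Interval

/-- Differentiation under the integral sign over a compact interval, for an integrand which is
jointly continuously differentiable along the interval. -/
theorem hasFDerivAt_intervalIntegral_of_contDiffAt {𝕜 H E : Type*} [RCLike 𝕜]
    [NormedAddCommGroup H] [NormedSpace 𝕜 H] [NormedAddCommGroup E] [NormedSpace 𝕜 E]
    [NormedSpace ℝ E] {a b : ℝ} (hab : a ≤ b) {F : H × 𝕜 → E} {x₀ : H}
    (hF : ∀ t ∈ Icc a b, ContDiffAt 𝕜 1 F (x₀, (t : 𝕜))) :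
    ContinuousOn (fun t : ℝ => (fderiv 𝕜 F (x₀, (t : 𝕜))).comp (.inl 𝕜 H 𝕜)) (Icc a b) ∧
    HasFDerivAt (fun x => ∫ t in a..b, F (x, (t : 𝕜)))
      (∫ t in a..b, (fderiv 𝕜 F (x₀, (t : 𝕜))).comp (.inl 𝕜 H 𝕜)) x₀ := by
  let F' : H → ℝ → H →L[𝕜] E := fun x t => (fderiv 𝕜 F (x, (t : 𝕜))).comp (.inl 𝕜 H 𝕜)
  have hcoe : ∀ (x : H) (t : ℝ), ContinuousAt (fun q : H × ℝ => (q.1, (q.2 : 𝕜))) (x, t) := by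
    intro x t
    have : Continuous (fun q : H × ℝ => (q.1, (q.2 : 𝕜))) := by
      refine continuous_fst.prodMk ?_
      exact RCLike.continuous_ofReal.comp continuous_snd
    exact this.continuousAt
  have hev : ∀ t ∈ Icc a b, ∀ᶠ q : H × ℝ in 𝓝 (x₀, t), ContDiffAt 𝕜 1 F (q.1, (q.2 : 𝕜)) := by
    intro t ht
    exact (hcoe x₀ t).eventually ((hF t ht).eventually (by simp))
  have hC : ∀ᶠ x in 𝓝 x₀, ∀ t ∈ Icc a b, ContDiffAt 𝕜 1 F (x, (t : 𝕜)) :=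
    isCompact_Icc.eventually_forall_of_forall_eventually hev
  have hF'c : ∀ (x : H) (t : ℝ), ContDiffAt 𝕜 1 F (x, (t : 𝕜)) →
      ContinuousAt (fun q : H × ℝ => F' q.1 q.2) (x, t) := by
    intro x t h
    have h1 : ContinuousAt (fderiv 𝕜 F) (x, (t : 𝕜)) := h.continuousAt_fderiv (by simp)
    have h2 : ContinuousAt (fun q : H × ℝ => fderiv 𝕜 F (q.1, (q.2 : 𝕜))) (x, t) :=
      ContinuousAt.comp (g := fderiv 𝕜 F) (f := fun q : H × ℝ => (q.1, (q.2 : 𝕜))) h1 (hcoe x t)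
    exact h2.clm_comp continuousAt_const
  have hF'x : ∀ x, (∀ t ∈ Icc a b, ContDiffAt 𝕜 1 F (x, (t : 𝕜))) →
      ContinuousOn (F' x) (Icc a b) := by
    intro x hx t ht
    have h2 : ContinuousAt (fun s : ℝ => (x, s)) t := by fun_prop
    exact (ContinuousAt.comp (g := fun q : H × ℝ => F' q.1 q.2) (f := fun s : ℝ => (x, s))
      (hF'c x t (hx t ht)) h2).continuousWithinAt
  have hFx : ∀ x, (∀ t ∈ Icc a b, ContDiffAt 𝕜 1 F (x, (t : 𝕜))) →
      ContinuousOn (fun t : ℝ => F (x, (t : 𝕜))) (Icc a b) := by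
    intro x hx t ht
    have h2 : ContinuousAt (fun s : ℝ => (x, (s : 𝕜))) t :=
      ContinuousAt.comp (g := fun q : H × ℝ => (q.1, (q.2 : 𝕜))) (f := fun s : ℝ => (x, s))
        (hcoe x t) (by fun_prop)
    exact (ContinuousAt.comp (g := F) (f := fun s : ℝ => (x, (s : 𝕜)))
      (hx t ht).continuousAt h2).continuousWithinAt
  obtain ⟨M, hM⟩ := isCompact_Icc.exists_bound_of_continuousOn (hF'x x₀ hF)
  -- By compactness the bound M on the fibre over x₀ survives, with slack 1, on a whole
  -- neighbourhood of x₀. The constant M + 1 is then the dominating function.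
  have hB : ∀ᶠ x in 𝓝 x₀, ∀ t ∈ Icc a b, ‖F' x t‖ < M + 1 := by
    refine isCompact_Icc.eventually_forall_of_forall_eventually fun t ht => ?_
    have h1 := (hF'c x₀ t (hF t ht)).norm
    exact h1.eventually_lt_const (by linarith [hM t ht])
  refine ⟨hF'x x₀ hF, ?_⟩
  have hIoc : Ι a b ⊆ Icc a b := by rw [uIoc_of_le hab]; exact Ioc_subset_Icc_self
  refine intervalIntegral.hasFDerivAt_integral_of_dominated_of_fderiv_le
    (F' := F') (bound := fun _ => M + 1) (hC.and hB) ?_ ?_ ?_ ?_ ?_ ?_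
  · filter_upwards [hC] with x hx
    exact ((hFx x hx).mono hIoc).aestronglyMeasurable measurableSet_uIoc
  · exact ContinuousOn.intervalIntegrable_of_Icc hab (hFx x₀ hF)
  · exact ((hF'x x₀ hF).mono hIoc).aestronglyMeasurable measurableSet_uIoc
  · exact .of_forall fun t ht x hx => (hx.2 t (hIoc ht)).le
  · exact intervalIntegrable_const
  · refine .of_forall fun t ht x hx => ?_
    have h1 := ((hx.1 t (hIoc ht)).differentiableAt (by simp)).hasFDerivAt
    exact h1.comp x (hasFDerivAt_prodMk_left x (t : 𝕜))

end

/-! ### Eigenvectors and exponentials in finite-dimensional and Banach algebras -/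

section

open Set Filter Topology MeasureTheory
open scoped Interval
open NormedSpace

section EigenvectorLemmas

variable {V : Type*} [AddCommGroup V] [Module ℂ V] [FiniteDimensional ℂ V]

theorem Module.End.exists_eigenvector_mem_of_invariant (f : Module.End ℂ V) {W : Submodule ℂ V}
    (hW : W ≠ ⊥) (hf : ∀ w ∈ W, f w ∈ W) : ∃ v ∈ W, v ≠ 0 ∧ ∃ a : ℂ, f v = a • v := by
  have : Nontrivial W := Submodule.nontrivial_iff_ne_bot.mpr hW
  obtain ⟨a, ha⟩ := Module.End.exists_eigenvalue (f.restrict hf)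
  obtain ⟨v, hv⟩ := ha.exists_hasEigenvector
  refine ⟨v, v.2, by simpa using hv.2, a, ?_⟩
  simpa using congrArg Subtype.val hv.apply_eq_smul

/-- Since f and g commute, g preserves the part of an eigenspace of f inside W, and so has an
eigenvector there. This is used both for uniqueness of logarithms and for injectivity of Sylvester
operators. -/
theorem Module.End.exists_common_eigenvector_mem_of_invariant (f g : Module.End ℂ V)
    (hfg : ∀ v, f (g v) = g (f v)) {W : Submodule ℂ V} (hW : W ≠ ⊥) (hf : ∀ w ∈ W, f w ∈ W)
    (hg : ∀ w ∈ W, g w ∈ W) :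
    ∃ v ∈ W, v ≠ 0 ∧ ∃ a b : ℂ, f v = a • v ∧ g v = b • v := by
  obtain ⟨v, hvW, hv0, a, hva⟩ := f.exists_eigenvector_mem_of_invariant hW hf
  have h1 : W ⊓ f.eigenspace a ≠ ⊥ :=
    (Submodule.ne_bot_iff _).mpr ⟨v, ⟨hvW, Module.End.mem_eigenspace_iff.mpr hva⟩, hv0⟩
  obtain ⟨w, ⟨hwW, hwa⟩, hw0, b, hwb⟩ := g.exists_eigenvector_mem_of_invariant h1 (by
    rintro w ⟨hw, hw'⟩
    refine ⟨hg w hw, ?_⟩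
    have hw2 := Module.End.mem_eigenspace_iff.mp hw'
    exact Module.End.mem_eigenspace_iff.mpr (by rw [hfg, hw2, map_smul]))
  exact ⟨w, hwW, hw0, a, b, Module.End.mem_eigenspace_iff.mp hwa, hwb⟩

end EigenvectorLemmas

section Algebra

variable {𝔸 : Type*} [Ring 𝔸] [Algebra ℂ 𝔸] [FiniteDimensional ℂ 𝔸]

/-- If left multiplication by y is injective, then finite dimension makes it surjective; a preimage
of 1 is a right inverse, and injectivity makes it a left inverse too. -/
theorem exists_ne_zero_mul_eq_zero_of_not_isUnit {y : 𝔸} (hy : ¬ IsUnit y) :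
    ∃ v, v ≠ 0 ∧ y * v = 0 := by
  by_contra! h
  have hinj : Function.Injective (LinearMap.mulLeft ℂ y) :=
    (injective_iff_map_eq_zero _).mpr fun v hv => by
      by_contra h0
      exact h v h0 hv
  obtain ⟨w, hw⟩ := LinearMap.injective_iff_surjective.mp hinj 1
  have hw1 : y * w = 1 := hw
  have hw2 : w * y = 1 := hinj (by simp [← mul_assoc, hw1])
  exact hy ⟨⟨y, w, hw1, hw2⟩, rfl⟩

/-- The algebra acts on itself by left multiplication, so its own elements serve as eigenvectors and
no underlying vector space is needed. -/
theorem mem_spectrum_iff_exists_mul_eq_smul {x : 𝔸} {z : ℂ} :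
    z ∈ spectrum ℂ x ↔ ∃ v, v ≠ 0 ∧ x * v = z • v := by
  rw [spectrum.mem_iff]
  constructor
  · intro h
    obtain ⟨v, hv, h0⟩ := exists_ne_zero_mul_eq_zero_of_not_isUnit h
    exact ⟨v, hv, by simpa [sub_mul, Algebra.algebraMap_eq_smul_one, sub_eq_zero, eq_comm] using h0⟩
  · rintro ⟨v, hv, h⟩ hu
    exact hv (hu.mul_right_eq_zero.mp (by simp [sub_mul, Algebra.algebraMap_eq_smul_one, h]))

end Algebra

section Exponential

variable {𝔸 : Type*} [NormedRing 𝔸] [NormedAlgebra ℂ 𝔸] [CompleteSpace 𝔸]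

theorem NormedSpace.exp_mul_eq_of_mul_eq_smul {x v : 𝔸} {a : ℂ} (h : x * v = a • v) :
    exp x * v = Complex.exp a • v := by
  have hp : ∀ k : ℕ, x ^ k * v = a ^ k • v := by
    intro k
    induction k with
    | zero => simp
    | succ k ih => rw [pow_succ', mul_assoc, ih, mul_smul_comm, h, smul_smul, pow_succ]
  have h1 := (exp_series_hasSum_exp' (𝕂 := ℂ) x).mul_right v
  have h2 := (exp_series_hasSum_exp' (𝕂 := ℂ) a).smul_const v
  rw [← Complex.exp_eq_exp_ℂ] at h2
  refine h1.unique ?_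
  simpa only [smul_mul_assoc, hp, smul_assoc] using h2

/-- The chain rule for the exponential along a path of commuting elements. -/
theorem hasDerivAt_exp_of_commute {𝕜 : Type*} [RCLike 𝕜] [NormedAlgebra 𝕜 𝔸] {F : 𝕜 → 𝔸} {F' : 𝔸}
    {t : 𝕜} (hF : HasDerivAt F F' t) (hc : ∀ᶠ s in 𝓝 t, Commute (F t) (F s)) :
    HasDerivAt (fun s => exp (F s)) (exp (F t) * F') t := by
  have h0 : HasFDerivAt exp (1 : 𝔸 →L[𝕜] 𝔸) (F t - F t) := by
    rw [sub_self]; exact hasFDerivAt_exp_zero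
  have h1 : HasDerivAt (fun s => exp (F s - F t)) F' t := by
    exact h0.comp_hasDerivAt t (hF.sub_const (F t))
  -- By commutation exp (F s) = exp (F t) · exp (F s - F t), so only the derivative of the
  -- exponential at 0 is needed.
  refine (h1.const_mul (exp (F t))).congr_of_eventuallyEq ?_
  filter_upwards [hc] with s hs
  let _ : NormedAlgebra ℚ 𝔸 := NormedAlgebra.restrictScalars ℚ ℂ 𝔸
  rw [← exp_add_of_commute (hs.sub_right (Commute.refl _))]
  congr 1
  abel

end Exponential

end

/-! ### The principal logarithm as an integral: existence, uniqueness, derivative -/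

section

open Set Filter Topology MeasureTheory
open scoped Interval
open NormedSpace

section IntegralLog

variable {𝔸 : Type*} [NormedRing 𝔸] [NormedAlgebra ℂ 𝔸]

/-- The elements `R` for which the segment from `1` to `R` consists of units. In a complex matrix
algebra, they are the matrices without eigenvalues on the closed negative real axis. -/
def logDomain (𝔸 : Type*) [NormedRing 𝔸] [NormedAlgebra ℂ 𝔸] : Set 𝔸 :=
  {R | ∀ t ∈ Icc (0 : ℝ) 1, IsUnit (1 + (t : ℂ) • (R - 1))}

/-- The integrand of the integral representation of the logarithm. -/
noncomputable def logIntegrand (q : 𝔸 × ℂ) : 𝔸 := (q.1 - 1) * Ring.inverse (1 + q.2 • (q.1 - 1))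

/-- The principal logarithm `∫₀¹ (R - 1) (1 + t (R - 1))⁻¹ dt`. -/
noncomputable def integralLog (R : 𝔸) : 𝔸 := ∫ t in (0 : ℝ)..1, logIntegrand (R, (t : ℂ))

theorem isUnit_of_mem_logDomain {R : 𝔸} (hR : R ∈ logDomain 𝔸) : IsUnit R := by
  simpa using hR 1 (by simp)

variable [CompleteSpace 𝔸]

theorem isOpen_logDomain : IsOpen (logDomain 𝔸) := by
  rw [isOpen_iff_mem_nhds]
  intro R hR
  refine isCompact_Icc.eventually_forall_of_forall_eventually fun t ht => ?_
  have hc : Continuous fun q : 𝔸 × ℝ => 1 + (q.2 : ℂ) • (q.1 - 1) := by fun_prop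
  exact hc.continuousAt.eventually (Units.isOpen.eventually_mem (hR t ht))

theorem contDiffAt_logIntegrand {R : 𝔸} {s : ℂ} (h : IsUnit (1 + s • (R - 1))) :
    ContDiffAt ℂ 1 (logIntegrand (𝔸 := 𝔸)) (R, s) := by
  have h1 : ContDiffAt ℂ 1 (fun q : 𝔸 × ℂ => 1 + q.2 • (q.1 - 1)) (R, s) := by fun_prop
  obtain ⟨u, hu⟩ := h
  have h2 : ContDiffAt ℂ 1 (Ring.inverse : 𝔸 → 𝔸) (1 + s • (R - 1)) :=
    hu ▸ contDiffAt_ringInverse ℂ u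
  have h3 : ContDiffAt ℂ 1 (fun q : 𝔸 × ℂ => q.1 - 1) (R, s) := by fun_prop
  exact h3.mul (ContDiffAt.comp (R, s) (g := Ring.inverse)
    (f := fun q : 𝔸 × ℂ => 1 + q.2 • (q.1 - 1)) h2 h1)

theorem differentiableAt_integralLog {R : 𝔸} (hR : R ∈ logDomain 𝔸) :
    DifferentiableAt ℂ (integralLog (𝔸 := 𝔸)) R :=
  (hasFDerivAt_intervalIntegral_of_contDiffAt zero_le_one
    fun t ht => contDiffAt_logIntegrand (hR t ht)).2.differentiableAt

theorem continuousAt_logIntegrand {R : 𝔸} {t : ℝ} (h : IsUnit (1 + (t : ℂ) • (R - 1))) :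
    ContinuousAt (fun t : ℝ => logIntegrand (R, (t : ℂ))) t :=
  ContinuousAt.comp (g := logIntegrand) (f := fun t : ℝ => (R, (t : ℂ)))
    (contDiffAt_logIntegrand h).continuousAt (by fun_prop)

theorem intervalIntegrable_logIntegrand {R : 𝔸} (hR : R ∈ logDomain 𝔸) {s : ℝ}
    (hs : s ∈ Icc (0 : ℝ) 1) :
    IntervalIntegrable (fun t : ℝ => logIntegrand (R, (t : ℂ))) volume 0 s :=
  ContinuousOn.intervalIntegrable_of_Icc hs.1 fun t ht =>
    (continuousAt_logIntegrand (hR t ⟨ht.1, ht.2.trans hs.2⟩)).continuousWithinAt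

theorem commute_ringInverse {M : Type*} [MonoidWithZero M] {x y : M} (h : Commute x y) :
    Commute x (Ring.inverse y) := by
  by_cases hy : IsUnit y
  · obtain ⟨u, rfl⟩ := hy
    rw [Ring.inverse_unit]
    exact h.units_inv_right
  · rw [Ring.inverse_non_unit _ hy]
    exact Commute.zero_right _

omit [CompleteSpace 𝔸] in
theorem commute_logIntegrand {x R : 𝔸} (h : Commute x R) (s : ℂ) :
    Commute x (logIntegrand (R, s)) := by
  have h1 : Commute x (R - 1) := h.sub_right (Commute.one_right x)
  exact h1.mul_right (commute_ringInverse ((Commute.one_right x).add_right (h1.smul_right s)))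

theorem commute_integral_of_forall {x : 𝔸} {a b : ℝ} {f : ℝ → 𝔸}
    (hf : IntervalIntegrable f volume a b) (h : ∀ t, Commute x (f t)) :
    Commute x (∫ t in a..b, f t) := by
  have h1 := (ContinuousLinearMap.mul ℂ 𝔸 x).intervalIntegral_comp_comm hf
  have h2 := ((ContinuousLinearMap.mul ℂ 𝔸).flip x).intervalIntegral_comp_comm hf
  have h3 : ∀ t, (ContinuousLinearMap.mul ℂ 𝔸 x) (f t) =
    ((ContinuousLinearMap.mul ℂ 𝔸).flip x) (f t) := fun t => h t
  simp_rw [h3] at h1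
  exact h1.symm.trans h2

theorem commute_integralLog {x R : 𝔸} (hR : R ∈ logDomain 𝔸) (h : Commute x R) :
    Commute x (integralLog R) :=
  commute_integral_of_forall (intervalIntegrable_logIntegrand hR (by simp))
    fun t => commute_logIntegrand h _

/-- With φ(s) the integral over [0, s], the product ψ(s) = exp(-φ(s)) (1 + s(R - 1)) has zero
derivative on [0, 1], because φ' is the logarithmic derivative of the second factor. Comparing s = 0
with s = 1 gives the claim. -/
theorem exp_integralLog {R : 𝔸} (hR : R ∈ logDomain 𝔸) : exp (integralLog R) = R := by
  let _ : NormedAlgebra ℚ 𝔸 := NormedAlgebra.restrictScalars ℚ ℂ 𝔸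
  let f : ℝ → 𝔸 := fun t => logIntegrand (R, (t : ℂ))
  let φ : ℝ → 𝔸 := fun s => ∫ t in (0 : ℝ)..s, f t
  let ψ : ℝ → 𝔸 := fun s => exp (-φ s) * (1 + (s : ℂ) • (R - 1))
  have hopen : IsOpen {t : ℝ | IsUnit (1 + (t : ℂ) • (R - 1))} :=
    Units.isOpen.preimage (by fun_prop)
  have hff : ∀ s t, Commute (f s) (f t) := fun s t =>
    commute_logIntegrand (commute_logIntegrand (Commute.refl R) _).symm _
  have hφ : ∀ s ∈ Icc (0 : ℝ) 1, HasDerivAt φ (f s) s := fun s hs =>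
    intervalIntegral.integral_hasDerivAt_right (intervalIntegrable_logIntegrand hR hs)
      (ContinuousOn.stronglyMeasurableAtFilter hopen
        (fun t ht => (continuousAt_logIntegrand ht).continuousWithinAt) s (hR s hs))
      (continuousAt_logIntegrand (hR s hs))
  have hφφ : ∀ s ∈ Icc (0 : ℝ) 1, ∀ᶠ t in 𝓝 s, Commute (-φ s) (-φ t) := by
    intro s hs
    -- The derivative is two-sided, so t may leave [0, 1]; inside this ball the segment from s to t
    -- still consists of parameters with invertible 1 + t(R - 1), and the integrand stays
    -- integrable.
    obtain ⟨ε, hε, hb⟩ := Metric.isOpen_iff.mp hopen s (hR s hs)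
    filter_upwards [Metric.ball_mem_nhds s hε] with t ht
    have hseg : IntervalIntegrable f volume s t := by
      refine ContinuousOn.intervalIntegrable fun u hu => ?_
      refine (continuousAt_logIntegrand (hb ?_)).continuousWithinAt
      exact (convex_ball s ε).segment_subset (Metric.mem_ball_self hε) ht
        (segment_eq_uIcc s t ▸ hu)
    have hs0 := intervalIntegrable_logIntegrand hR hs
    refine Commute.neg_left (Commute.neg_right ?_)
    refine commute_integral_of_forall (hs0.trans hseg) fun u => ?_
    exact (commute_integral_of_forall hs0 fun v => hff u v).symm
  have hψ : ∀ s ∈ Icc (0 : ℝ) 1, HasDerivAt ψ 0 s := by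
    intro s hs
    have h1 := hasDerivAt_exp_of_commute (hφ s hs).neg (hφφ s hs)
    have h2 : HasDerivAt (fun s : ℝ => 1 + (s : ℂ) • (R - 1)) (R - 1) s := by
      have := (Complex.ofRealCLM.hasDerivAt (x := s)).smul_const (R - 1)
      simpa using this.const_add 1
    have h4 : HasDerivAt ψ _ s := h1.mul h2
    refine h4.congr_deriv ?_
    have h3 : f s * (1 + (s : ℂ) • (R - 1)) = R - 1 := by
      simp only [f, logIntegrand, mul_assoc]
      rw [Ring.inverse_mul_cancel _ (hR s hs), mul_one]
    rw [mul_assoc, neg_mul, h3, mul_neg]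
    exact neg_add_cancel _
  have h1 := constant_of_has_deriv_right_zero (f := ψ) (a := 0) (b := 1)
    (fun s hs => (hψ s hs).continuousAt.continuousWithinAt)
    (fun s hs => (hψ s (Ico_subset_Icc_self hs)).hasDerivWithinAt) 1 (by simp)
  have h0 : exp (-φ 1) * R = 1 := by
    simpa [ψ, φ] using h1
  have h2 : exp (-integralLog R) * R = 1 := h0
  calc exp (integralLog R) = exp (integralLog R) * (exp (-integralLog R) * R) := by
        rw [h2, mul_one]
    _ = R := by
      rw [← mul_assoc, ← exp_add_of_commute (Commute.refl _).neg_right, add_neg_cancel, exp_zero,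
        one_mul]

omit [CompleteSpace 𝔸] in
theorem mem_slitPlane_of_mul_eq_smul {R v : 𝔸} {z : ℂ} (hR : R ∈ logDomain 𝔸) (hv : v ≠ 0)
    (h : R * v = z • v) : z ∈ Complex.slitPlane := by
  have h1 : ∀ t : ℝ, (1 + (t : ℂ) • (R - 1)) * v = (1 + t * (z - 1)) • v := by
    intro t
    rw [add_mul, smul_mul_assoc, sub_mul, h, one_mul, add_smul, one_smul, mul_smul, sub_smul,
      one_smul]
  by_contra hz
  rw [Complex.mem_slitPlane_iff, not_or, not_lt, not_not] at hz
  obtain ⟨hre, him⟩ := hz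
  have hz' : z = (z.re : ℂ) := Complex.ext (by simp) (by simp [him])
  have hpos : 0 < 1 - z.re := by linarith
  -- For real z ≤ 0 this t in (0, 1] is the root of 1 + t(z - 1), so v would be killed by a unit.
  have hu := hR (1 / (1 - z.re)) ⟨by positivity, by rw [div_le_one hpos]; linarith⟩
  refine hv (hu.mul_right_eq_zero.mp ?_)
  rw [h1, hz']
  have : (1 + ((1 / (1 - z.re) : ℝ) : ℂ) * ((z.re : ℂ) - 1)) = 0 := by
    rw [← Complex.ofReal_one, ← Complex.ofReal_sub, ← Complex.ofReal_mul, ← Complex.ofReal_add,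
      Complex.ofReal_eq_zero]
    field_simp
    ring
  simp only [Complex.ofReal_re]
  rw [this, zero_smul]

/-- On an eigenvector the integrand acts as the scalar (z - 1)/(1 + t(z - 1)), whose integral over
[0, 1] is the scalar logarithm. -/
theorem integralLog_mul_eq_smul {R v : 𝔸} {z : ℂ} (hR : R ∈ logDomain 𝔸) (hv : v ≠ 0)
    (h : R * v = z • v) : integralLog R * v = Complex.log z • v := by
  have hz := mem_slitPlane_of_mul_eq_smul hR hv h
  have h1 : ∀ t : ℝ, (1 + (t : ℂ) • (R - 1)) * v = (1 + t * (z - 1)) • v := by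
    intro t
    rw [add_mul, smul_mul_assoc, sub_mul, h, one_mul, add_smul, one_smul, mul_smul, sub_smul,
      one_smul]
  have h2 : ∀ t ∈ uIcc (0 : ℝ) 1,
      logIntegrand (R, (t : ℂ)) * v = ((z - 1) * (1 + t • (z - 1))⁻¹) • v := by
    intro t ht
    rw [uIcc_of_le zero_le_one] at ht
    have hu := hR t ht
    have hne : (1 + t * (z - 1)) ≠ 0 := by
      intro h0
      exact hv (hu.mul_right_eq_zero.mp (by rw [h1, h0, zero_smul]))
    have h3 : Ring.inverse (1 + (t : ℂ) • (R - 1)) * v = (1 + t * (z - 1))⁻¹ • v := by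
      have h4 : v = (1 + t * (z - 1))⁻¹ • ((1 + (t : ℂ) • (R - 1)) * v) := by
        rw [h1, smul_smul, inv_mul_cancel₀ hne, one_smul]
      conv_lhs => rw [h4]
      rw [mul_smul_comm, ← mul_assoc, Ring.inverse_mul_cancel _ hu, one_mul]
    simp only [logIntegrand, mul_assoc]
    rw [h3, mul_smul_comm, sub_mul, one_mul, h, Complex.real_smul, mul_comm (z - 1), mul_smul, sub_smul,
      one_smul]
  have h3 := ((ContinuousLinearMap.mul ℂ 𝔸).flip v).intervalIntegral_comp_comm
    (intervalIntegrable_logIntegrand hR (s := 1) (by simp))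
  have h4 : integralLog R * v = ∫ t in (0 : ℝ)..1, logIntegrand (R, (t : ℂ)) * v := h3.symm
  rw [h4, intervalIntegral.integral_congr h2, intervalIntegral.integral_smul_const,
    intervalIntegral.integral_const_mul, ← Complex.log_eq_integral (by simpa using hz)]
  simp

section FiniteDimensional

variable [FiniteDimensional ℂ 𝔸]

/-- The element R commutes with its logarithm, so each eigenspace of the logarithm contains an
eigenvector of R, with some eigenvalue a in the slit plane. Then z = log a, and the argument of a is
strictly between -π and π. -/
theorem im_mem_of_mem_spectrum_integralLog {R : 𝔸} (hR : R ∈ logDomain 𝔸) {z : ℂ}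
    (hz : z ∈ spectrum ℂ (integralLog R)) : -Real.pi < z.im ∧ z.im < Real.pi := by
  obtain ⟨v, hv, hzv⟩ := mem_spectrum_iff_exists_mul_eq_smul.mp hz
  have hc := commute_integralLog hR (Commute.refl R)
  obtain ⟨w, hw, hw0, a, ha⟩ := Module.End.exists_eigenvector_mem_of_invariant
    (LinearMap.mulLeft ℂ R) (W := Module.End.eigenspace (LinearMap.mulLeft ℂ (integralLog R)) z)
    ((Submodule.ne_bot_iff _).mpr ⟨v, Module.End.mem_eigenspace_iff.mpr hzv, hv⟩) (by
      intro w hw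
      have hw' : integralLog R * w = z • w := Module.End.mem_eigenspace_iff.mp hw
      refine Module.End.mem_eigenspace_iff.mpr ?_
      simp only [LinearMap.mulLeft_apply]
      rw [← mul_assoc, ← hc.eq, mul_assoc, hw', mul_smul_comm])
  have hw' : integralLog R * w = z • w := Module.End.mem_eigenspace_iff.mp hw
  have h1 := mem_slitPlane_of_mul_eq_smul hR hw0 ha
  rw [integralLog_mul_eq_smul hR hw0 ha] at hw'
  have h2 : Complex.log a = z := smul_left_injective ℂ hw0 hw'
  rw [← h2, Complex.log_im]
  exact ⟨Complex.neg_pi_lt_arg a, lt_of_le_of_ne (Complex.arg_le_pi a)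
    (Complex.slitPlane_arg_ne_pi h1)⟩

/-- Two commuting elements with equal exponentials are equal when their spectra lie in the strip
of imaginary parts in `(-π, π)`. -/
theorem eq_of_exp_eq_of_commute {x y : 𝔸} (hxy : Commute x y) (h : exp x = exp y)
    (hx : ∀ z ∈ spectrum ℂ x, -Real.pi < z.im ∧ z.im < Real.pi)
    (hy : ∀ z ∈ spectrum ℂ y, -Real.pi < z.im ∧ z.im < Real.pi) : x = y := by
  let _ : NormedAlgebra ℚ 𝔸 := NormedAlgebra.restrictScalars ℚ ℂ 𝔸
  let N : 𝔸 := x - y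
  let f : ℝ → 𝔸 := fun s => exp (s • N)
  have hfd : ∀ s, HasDerivAt f (N * f s) s := fun s => hasDerivAt_exp_smul_const' N s
  have hfc : Continuous f := continuous_iff_continuousAt.mpr fun s => (hfd s).continuousAt
  have hfi : IntervalIntegrable f volume 0 1 := hfc.intervalIntegrable _ _
  -- E plays the role of (exp N - 1)/N, so N E = exp N - 1 = 0. If E is a unit, N = 0. Otherwise x
  -- and y have a common eigenvector w in the kernel of E; the strip condition forces equal
  -- eigenvalues, so N w = 0, E w = w, and w = 0.
  let E : 𝔸 := ∫ s in (0 : ℝ)..1, f s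
  have hexpN : exp N = 1 := by
    have : N = x + -y := sub_eq_add_neg x y
    rw [this, exp_add_of_commute hxy.neg_right, h, ← exp_add_of_commute (Commute.refl y).neg_right,
      add_neg_cancel, exp_zero]
  have hNE : N * E = 0 := by
    have h1 : N * E = ∫ s in (0 : ℝ)..1, N * f s :=
      ((ContinuousLinearMap.mul ℂ 𝔸 N).intervalIntegral_comp_comm hfi).symm
    rw [h1, intervalIntegral.integral_eq_sub_of_hasDerivAt (fun s _ => hfd s)
      ((continuous_const.mul hfc).intervalIntegrable _ _)]
    simp [f, hexpN]
  have hcomm : ∀ {u : 𝔸}, Commute u N → Commute u E := fun {u} hu =>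
    commute_integral_of_forall hfi fun s => (hu.smul_right s).exp_right
  by_cases hE : IsUnit E
  · exact sub_eq_zero.mp (hE.mul_left_eq_zero.mp hNE)
  exfalso
  obtain ⟨v, hv, hEv⟩ := exists_ne_zero_mul_eq_zero_of_not_isUnit hE
  have hxN : Commute x N := (Commute.refl x).sub_right hxy
  have hyN : Commute y N := hxy.symm.sub_right (Commute.refl y)
  have hker : ∀ u, Commute u N → ∀ w ∈ LinearMap.ker (LinearMap.mulLeft ℂ E),
      LinearMap.mulLeft ℂ u w ∈ LinearMap.ker (LinearMap.mulLeft ℂ E) := by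
    intro u hu w hw
    have hw' : E * w = 0 := hw
    change E * (u * w) = 0
    rw [← mul_assoc, ← (hcomm hu).eq, mul_assoc, hw', mul_zero]
  obtain ⟨w, hw, hw0, a, b, ha, hb⟩ := Module.End.exists_common_eigenvector_mem_of_invariant
    (LinearMap.mulLeft ℂ x) (LinearMap.mulLeft ℂ y)
    (fun v => by simp only [LinearMap.mulLeft_apply, ← mul_assoc, hxy.eq])
    ((Submodule.ne_bot_iff _).mpr ⟨v, hEv, hv⟩) (hker x hxN) (hker y hyN)
  have hw' : E * w = 0 := hw
  have ha' : x * w = a • w := ha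
  have hb' : y * w = b • w := hb
  have hab : a = b := by
    have h1 : Complex.exp a • w = Complex.exp b • w := by
      rw [← exp_mul_eq_of_mul_eq_smul ha', h, exp_mul_eq_of_mul_eq_smul hb']
    have h2 : Complex.exp a = Complex.exp b := smul_left_injective ℂ hw0 h1
    obtain ⟨hx1, hx2⟩ := hx a (mem_spectrum_iff_exists_mul_eq_smul.mpr ⟨w, hw0, ha'⟩)
    obtain ⟨hy1, hy2⟩ := hy b (mem_spectrum_iff_exists_mul_eq_smul.mpr ⟨w, hw0, hb'⟩)
    rw [← Complex.log_exp hx1 hx2.le, h2, Complex.log_exp hy1 hy2.le]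
  have hNw : N * w = (0 : ℂ) • w := by
    simp only [N, sub_mul, ha', hb', hab, sub_self, zero_smul]
  have hfw : ∀ s, f s * w = w := by
    intro s
    have h1 : (s • N) * w = (0 : ℂ) • w := by
      rw [smul_mul_assoc, hNw, zero_smul, smul_zero]
    simpa using exp_mul_eq_of_mul_eq_smul h1
  have h1 : E * w = ∫ s in (0 : ℝ)..1, f s * w :=
    (((ContinuousLinearMap.mul ℂ 𝔸).flip w).intervalIntegral_comp_comm hfi).symm
  simp_rw [hfw] at h1
  rw [hw'] at h1
  exact hw0 (by simpa using h1.symm)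

/-- Any logarithm x commutes with R = exp x, hence with `integralLog R`, so the commuting case of
uniqueness is enough. -/
theorem eq_integralLog_of_exp_eq {R x : 𝔸} (hR : R ∈ logDomain 𝔸) (h : exp x = R)
    (hx : ∀ z ∈ spectrum ℂ x, -Real.pi < z.im ∧ z.im < Real.pi) : x = integralLog R :=
  eq_of_exp_eq_of_commute
    (commute_integralLog hR (h ▸ (Commute.refl x).exp_right)) (h.trans (exp_integralLog hR).symm) hx
    fun _ => im_mem_of_mem_spectrum_integralLog hR

end FiniteDimensional

/-- Differentiability is already known, and the path z·1 - x stays in a commutative family.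
Differentiating exp ∘ log = id by the commuting chain rule gives (z - x) · derivative = 1. -/
theorem hasDerivAt_integralLog_smul_one_sub {x : 𝔸} {z : ℂ} (h : z • 1 - x ∈ logDomain 𝔸) :
    HasDerivAt (fun w : ℂ => integralLog (w • 1 - x)) (Ring.inverse (z • 1 - x)) z := by
  have h1 : HasDerivAt (fun w : ℂ => w • (1 : 𝔸) - x) 1 z := by
    simpa using ((hasDerivAt_id z).smul_const (1 : 𝔸)).sub_const x
  have h2 := (differentiableAt_integralLog h).hasFDerivAt.comp_hasDerivAt z h1
  have hev : ∀ᶠ w in 𝓝 z, w • (1 : 𝔸) - x ∈ logDomain 𝔸 :=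
    h1.continuousAt.eventually (isOpen_logDomain.eventually_mem h)
  have h3 := hasDerivAt_exp_of_commute h2 (by
    filter_upwards [hev] with w hw
    refine commute_integralLog hw (commute_integralLog h ?_).symm
    refine Commute.sub_left ?_ ?_
    · exact (Commute.one_left _).smul_left w
    · exact ((Commute.one_right x).smul_right z).sub_right (Commute.refl x))
  have h4 : HasDerivAt (fun w : ℂ => exp (integralLog (w • 1 - x))) 1 z :=
    h1.congr_of_eventuallyEq (by filter_upwards [hev] with w hw using exp_integralLog hw)
  have h5 := h3.unique h4
  simp only [Function.comp_apply] at h5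
  rw [exp_integralLog h] at h5
  have h6 : Ring.inverse (z • 1 - x) = (fderiv ℂ integralLog (z • 1 - x)) (1 : 𝔸) := by
    calc _ = Ring.inverse (z • 1 - x) * ((z • 1 - x) *
          (fderiv ℂ integralLog (z • 1 - x)) (1 : 𝔸)) := by rw [h5, mul_one]
      _ = _ := Ring.inverse_mul_cancel_left _ _ (isUnit_of_mem_logDomain h)
  rw [h6]
  exact h2

end IntegralLog

end

/-! ### Matrix logarithms, resolvents, and S_ω as a band mean -/

section

open Set Filter Topology MeasureTheory
open scoped Interval Matrix
open NormedSpace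

section MatrixLogarithm

attribute [local instance] Matrix.linftyOpNormedRing Matrix.linftyOpNormedAlgebra

variable {n : ℕ}

theorem isPrincipalLog_integralLog {R : Matrix (Fin n) (Fin n) ℂ}
    (hR : R ∈ logDomain (Matrix (Fin n) (Fin n) ℂ)) : IsPrincipalLog R (integralLog R) :=
  ⟨exp_integralLog hR, fun _ => im_mem_of_mem_spectrum_integralLog hR⟩

theorem isPrincipalLog_matrixLog {R : Matrix (Fin n) (Fin n) ℂ}
    (hR : R ∈ logDomain (Matrix (Fin n) (Fin n) ℂ)) : IsPrincipalLog R (matrixLog R) := by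
  have h : ∃ X, IsPrincipalLog R X := ⟨_, isPrincipalLog_integralLog hR⟩
  rw [matrixLog, dif_pos h]
  exact h.choose_spec

theorem IsPrincipalLog.eq_integralLog {R X : Matrix (Fin n) (Fin n) ℂ}
    (hR : R ∈ logDomain (Matrix (Fin n) (Fin n) ℂ)) (h : IsPrincipalLog R X) :
    X = integralLog R :=
  eq_integralLog_of_exp_eq hR h.1 h.2

theorem matrixLog_eq_integralLog {R : Matrix (Fin n) (Fin n) ℂ}
    (hR : R ∈ logDomain (Matrix (Fin n) (Fin n) ℂ)) : matrixLog R = integralLog R :=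
  (isPrincipalLog_matrixLog hR).eq_integralLog hR

theorem differentiableAt_matrixLog {R : Matrix (Fin n) (Fin n) ℂ}
    (hR : R ∈ logDomain (Matrix (Fin n) (Fin n) ℂ)) :
    DifferentiableAt ℂ (matrixLog (n := n)) R :=
  (differentiableAt_integralLog hR).congr_of_eventuallyEq (by
    filter_upwards [isOpen_logDomain.mem_nhds hR] with x hx using matrixLog_eq_integralLog hx)

theorem IsPrincipalLog.map_star {R X : Matrix (Fin n) (Fin n) ℂ} (h : IsPrincipalLog R X) :
    IsPrincipalLog (R.map star) (X.map star) := by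
  have hmap : ∀ M : Matrix (Fin n) (Fin n) ℂ, M.map star = Mᴴᵀ := fun M => rfl
  refine ⟨by rw [hmap, hmap, Matrix.exp_transpose, Matrix.exp_conjTranspose, h.1], fun z hz => ?_⟩
  have h1 : star z ∈ spectrum ℂ X := by
    rw [spectrum.mem_iff] at hz ⊢
    contrapose! hz
    have h2 := hz.map (starRingEnd ℂ).mapMatrix
    convert h2 using 1
    ext i j
    simp [Matrix.algebraMap_matrix_apply, apply_ite]
  have := h.2 _ h1
  simp only [RCLike.star_def, Complex.conj_im] at this
  constructor <;> linarith [this.1, this.2]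

theorem mem_logDomain_map_star {R : Matrix (Fin n) (Fin n) ℂ}
    (hR : R ∈ logDomain (Matrix (Fin n) (Fin n) ℂ)) :
    R.map star ∈ logDomain (Matrix (Fin n) (Fin n) ℂ) := by
  intro t ht
  have h2 := (hR t ht).map (starRingEnd ℂ).mapMatrix
  convert h2 using 1
  ext i j
  by_cases hij : i = j <;> simp [hij]

/-- The strip is symmetric under conjugation, so the entrywise conjugate of a principal logarithm is
one of the conjugate matrix; uniqueness does the rest. -/
theorem integralLog_map_star {R : Matrix (Fin n) (Fin n) ℂ}
    (hR : R ∈ logDomain (Matrix (Fin n) (Fin n) ℂ)) :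
    integralLog (R.map star) = (integralLog R).map star :=
  ((isPrincipalLog_integralLog hR).map_star.eq_integralLog (mem_logDomain_map_star hR)).symm

theorem hasDerivAt_matrix_iff {𝕜 : Type*} [RCLike 𝕜] [NormedAlgebra 𝕜 ℂ] {a b : ℕ}
    {M : 𝕜 → Matrix (Fin a) (Fin b) ℂ} {M' : Matrix (Fin a) (Fin b) ℂ} {t : 𝕜} :
    HasDerivAt M M' t ↔ ∀ i j, HasDerivAt (fun s => M s i j) (M' i j) t := by
  have h1 := hasDerivAt_pi (𝕜 := 𝕜) (φ := fun s : 𝕜 => (M s : Fin a → Fin b → ℂ)) (φ' := M')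
    (x := t)
  refine h1.trans (forall_congr' fun i => ?_)
  exact hasDerivAt_pi

/-- The shifted matrix `iν I - A`. -/
def shiftedMatrix (A : Matrix (Fin n) (Fin n) ℝ) (ν : ℝ) : Matrix (Fin n) (Fin n) ℂ :=
  (Complex.I * (ν : ℂ)) • (1 : Matrix (Fin n) (Fin n) ℂ) - toComplexMatrix A

/-- The resolvent `(iν I - A)⁻¹`. -/
noncomputable def freqResolvent (A : Matrix (Fin n) (Fin n) ℝ) (ν : ℝ) : Matrix (Fin n) (Fin n) ℂ :=
  (shiftedMatrix A ν)⁻¹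

/-- The real part of the mean `(1/2π) ∫_{-ω}^{ω} F(ν) dν`, entry by entry. -/
noncomputable def bandMean {a b : ℕ} (ω : ℝ) (F : ℝ → Matrix (Fin a) (Fin b) ℂ) :
    Matrix (Fin a) (Fin b) ℝ :=
  Matrix.of fun i j => 1 / (2 * Real.pi) * ∫ ν in (-ω)..ω, (F ν i j).re

theorem negShift_eq_shiftedMatrix (ω : ℝ) (A : Matrix (Fin n) (Fin n) ℝ) :
    negShift ω A = shiftedMatrix A (-ω) := by
  simp only [negShift, shiftedMatrix, Complex.ofReal_neg, mul_neg, neg_smul]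
  abel

theorem shiftedMatrix_neg (A : Matrix (Fin n) (Fin n) ℝ) (ν : ℝ) :
    shiftedMatrix A (-ν) = (shiftedMatrix A ν).map star := by
  ext i j
  simp [shiftedMatrix, toComplexMatrix, Matrix.one_apply, apply_ite]

/-- For t > 0 the point of the segment is t times λ - A with λ = (1 - t)/t + iν. As Re λ ≥ 0, λ is
not an eigenvalue of A. -/
theorem IsHurwitz.shiftedMatrix_mem_logDomain {A : Matrix (Fin n) (Fin n) ℝ} (hA : IsHurwitz A)
    (ν : ℝ) : shiftedMatrix A ν ∈ logDomain (Matrix (Fin n) (Fin n) ℂ) := by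
  intro t ht
  rcases ht.1.eq_or_lt with rfl | h0
  · simp
  have h1 : 1 + (t : ℂ) • (shiftedMatrix A ν - 1) = (t : ℂ) •
      (algebraMap ℂ _ (((1 - t) / t : ℝ) + Complex.I * ν) - toComplexMatrix A) := by
    have ht' : (t : ℂ) ≠ 0 := by exact_mod_cast h0.ne'
    rw [Algebra.algebraMap_eq_smul_one, add_smul, smul_sub, smul_sub, smul_add, smul_smul]
    have : (t : ℂ) * (((1 - t) / t : ℝ) : ℂ) = 1 - t := by
      push_cast; field_simp
    rw [this, sub_smul, one_smul, shiftedMatrix, smul_sub]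
    abel
  have h2 : (((1 - t) / t : ℝ) + Complex.I * ν : ℂ) ∉ spectrum ℂ (toComplexMatrix A) := by
    intro hz
    have h3 := hA _ hz
    simp only [Complex.add_re, Complex.ofReal_re, Complex.mul_re, Complex.I_re, zero_mul,
      Complex.I_im, Complex.ofReal_im, mul_zero, sub_zero, add_zero] at h3
    have : 0 ≤ (1 - t) / t := div_nonneg (by linarith [ht.2]) ht.1
    linarith
  rw [h1]
  rw [spectrum.notMem_iff] at h2
  exact h2.smul (Units.mk0 (t : ℂ) (by exact_mod_cast h0.ne'))

/-- The matrices `A` such that `iν I - A` has no eigenvalue on the closed negative real axis for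
all `ν` in the frequency band. -/
def bandDomain (n : ℕ) (ω : ℝ) : Set (Matrix (Fin n) (Fin n) ℝ) :=
  {A | ∀ ν ∈ Icc (-ω) ω, shiftedMatrix A ν ∈ logDomain (Matrix (Fin n) (Fin n) ℂ)}

/-- Openness lets the band-mean formula for S_ω be applied to small perturbations of A and
differentiated there, with no need for the perturbations to be Hurwitz. -/
theorem isOpen_bandDomain (ω : ℝ) : IsOpen (bandDomain n ω) := by
  rw [isOpen_iff_mem_nhds]
  intro A hA
  refine isCompact_Icc.eventually_forall_of_forall_eventually fun ν hν => ?_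
  have hc : Continuous fun q : Matrix (Fin n) (Fin n) ℝ × ℝ => shiftedMatrix q.1 q.2 := by
    unfold shiftedMatrix toComplexMatrix
    have h1 : Continuous fun q : Matrix (Fin n) (Fin n) ℝ × ℝ => q.1.map Complex.ofReal :=
      continuous_fst.matrix_map Complex.continuous_ofReal
    have h2 : Continuous fun q : Matrix (Fin n) (Fin n) ℝ × ℝ => Complex.I * (q.2 : ℂ) := by
      fun_prop
    exact (h2.smul continuous_const).sub h1
  exact hc.continuousAt.eventually (isOpen_logDomain.eventually_mem (hA ν hν))

theorem IsHurwitz.mem_bandDomain {A : Matrix (Fin n) (Fin n) ℝ} (hA : IsHurwitz A) (ω : ℝ) :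
    A ∈ bandDomain n ω :=
  fun ν _ => hA.shiftedMatrix_mem_logDomain ν

theorem isUnit_shiftedMatrix {ω : ℝ} {A : Matrix (Fin n) (Fin n) ℝ} (hA : A ∈ bandDomain n ω)
    {ν : ℝ} (hν : ν ∈ Icc (-ω) ω) : IsUnit (shiftedMatrix A ν) :=
  isUnit_of_mem_logDomain (hA ν hν)

theorem negShift_mem_logDomain {ω : ℝ} (hω : 0 ≤ ω) {A : Matrix (Fin n) (Fin n) ℝ}
    (hA : A ∈ bandDomain n ω) : negShift ω A ∈ logDomain (Matrix (Fin n) (Fin n) ℂ) := by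
  rw [negShift_eq_shiftedMatrix]
  exact hA _ ⟨le_rfl, by linarith⟩

theorem hasDerivAt_matrix_inv {M : ℝ → Matrix (Fin n) (Fin n) ℂ} {M' : Matrix (Fin n) (Fin n) ℂ}
    {t : ℝ} (hM : ∀ i j, HasDerivAt (fun s => M s i j) (M' i j) t) (hu : IsUnit (M t)) (i j) :
    HasDerivAt (fun s => (M s)⁻¹ i j) ((-((M t)⁻¹ * M' * (M t)⁻¹)) i j) t := by
  revert i j
  rw [← hasDerivAt_matrix_iff (M := fun s => (M s)⁻¹)]
  obtain ⟨u, hu⟩ := hu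
  have h1 := hasFDerivAt_ringInverse (𝕜 := ℝ) u
  rw [hu] at h1
  have h2 := h1.comp_hasDerivAt t (hasDerivAt_matrix_iff.mpr hM)
  have h3 : ∀ N : Matrix (Fin n) (Fin n) ℂ, Ring.inverse N = N⁻¹ := fun N =>
    (Matrix.nonsing_inv_eq_ringInverse N).symm
  have h4 : ((u⁻¹ : (Matrix (Fin n) (Fin n) ℂ)ˣ) : Matrix (Fin n) (Fin n) ℂ) = (M t)⁻¹ := by
    rw [← h3, ← hu, Ring.inverse_unit]
  have h5 : (Ring.inverse ∘ M) = fun s => (M s)⁻¹ := funext fun s => h3 _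
  rw [h5] at h2
  exact h2.congr_deriv (by simp [h4])

theorem hasDerivAt_integralLog_shiftedMatrix {A : Matrix (Fin n) (Fin n) ℝ} {ν : ℝ}
    (h : shiftedMatrix A ν ∈ logDomain (Matrix (Fin n) (Fin n) ℂ)) (i j) :
    HasDerivAt (fun s : ℝ => integralLog (shiftedMatrix A s) i j)
      (freqResolvent A ν i j * Complex.I) ν := by
  have h1 := hasDerivAt_integralLog_smul_one_sub (x := toComplexMatrix A)
    (z := Complex.I * (ν : ℂ)) h
  rw [← Matrix.nonsing_inv_eq_ringInverse] at h1
  have h2 := hasDerivAt_matrix_iff.mp h1 i j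
  have h3 : HasDerivAt (fun s : ℝ => Complex.I * (s : ℂ)) Complex.I ν := by
    simpa using (Complex.ofRealCLM.hasDerivAt (x := ν)).const_mul Complex.I
  exact h2.comp ν h3

theorem continuousAt_freqResolvent {A : Matrix (Fin n) (Fin n) ℝ} {ν : ℝ}
    (h : IsUnit (shiftedMatrix A ν)) : ContinuousAt (freqResolvent A) ν := by
  have h1 : ∀ i j, HasDerivAt (fun s => shiftedMatrix A s i j)
      ((Complex.I • (1 : Matrix (Fin n) (Fin n) ℂ)) i j) ν := by
    intro i j
    have h3 : HasDerivAt (fun s : ℝ => Complex.I * (s : ℂ)) Complex.I ν := by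
      simpa using (Complex.ofRealCLM.hasDerivAt (x := ν)).const_mul Complex.I
    exact (h3.mul_const _).sub_const _
  exact (hasDerivAt_matrix_iff.mpr (hasDerivAt_matrix_inv h1 h)).continuousAt

theorem continuousOn_freqResolvent {ω : ℝ} {A : Matrix (Fin n) (Fin n) ℝ}
    (hA : A ∈ bandDomain n ω) : ContinuousOn (freqResolvent A) (Icc (-ω) ω) :=
  fun _ hν => (continuousAt_freqResolvent (isUnit_shiftedMatrix hA hν)).continuousWithinAt

/-- With L the logarithm of -iωI - A, integrating iR over the band gives L̄ - L = -2i Im L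
(entrywise conjugate). So the band mean of R is -(1/π) Im L, which is Re[(i/π)L]. -/
theorem freqS_eq_bandMean {ω : ℝ} (hω : 0 ≤ ω) {A : Matrix (Fin n) (Fin n) ℝ}
    (hA : A ∈ bandDomain n ω) : freqS ω A = bandMean ω (freqResolvent A) := by
  have hle : -ω ≤ ω := by linarith
  ext i j
  have hint : IntervalIntegrable (fun ν => freqResolvent A ν i j) volume (-ω) ω := by
    refine ContinuousOn.intervalIntegrable_of_Icc hle ?_
    exact (continuous_id.matrix_elem i j).comp_continuousOn (continuousOn_freqResolvent hA)
  have h1 := intervalIntegral.integral_eq_sub_of_hasDerivAt (a := -ω) (b := ω)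
    (fun ν hν => hasDerivAt_integralLog_shiftedMatrix (hA ν (uIcc_of_le hle ▸ hν)) i j)
    (hint.mul_const Complex.I)
  have h2 : shiftedMatrix A ω = (shiftedMatrix A (-ω)).map star := by
    rw [← shiftedMatrix_neg, neg_neg]
  rw [h2, integralLog_map_star (hA (-ω) ⟨le_rfl, hle⟩), intervalIntegral.integral_mul_const] at h1
  have h3 := Complex.reCLM.intervalIntegral_comp_comm hint
  simp only [Complex.reCLM_apply] at h3
  simp only [bandMean, Matrix.of_apply, h3]
  rw [freqS, matrixLog_eq_integralLog (negShift_mem_logDomain hω hA), negShift_eq_shiftedMatrix]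
  have h4 := congrArg Complex.im h1
  simp only [Matrix.map_apply, RCLike.star_def, Complex.mul_im, Complex.I_re, Complex.I_im,
    Complex.sub_im, Complex.conj_im, mul_zero, mul_one, add_zero] at h4
  simp only [Matrix.map_apply, Matrix.smul_apply, smul_eq_mul, h4]
  simp only [Complex.mul_re, Complex.div_ofReal_re, Complex.div_ofReal_im, Complex.I_re,
    Complex.I_im]
  field_simp
  ring

end MatrixLogarithm

end

/-! ### Sylvester equations with Hurwitz coefficients -/

section

open Set Filter Topology MeasureTheory
open scoped Interval Matrix

section Sylvester

theorem mem_spectrum_of_mul_eq_smul {a b : ℕ} {F : Matrix (Fin a) (Fin a) ℂ}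
    {X : Matrix (Fin a) (Fin b) ℂ} {z : ℂ} (hX : X ≠ 0) (h : F * X = z • X) :
    z ∈ spectrum ℂ F := by
  rw [spectrum.mem_iff]
  rintro ⟨u, hu⟩
  have h0 : (u : Matrix (Fin a) (Fin a) ℂ) * X = 0 := by
    rw [hu, Matrix.sub_mul, h, Algebra.algebraMap_eq_smul_one, Matrix.smul_mul, Matrix.one_mul,
      sub_self]
  apply hX
  calc X = (u⁻¹ * u : (Matrix (Fin a) (Fin a) ℂ)ˣ).val * X := by simp
    _ = 0 := by rw [Units.val_mul, Matrix.mul_assoc, h0, Matrix.mul_zero]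

theorem mem_spectrum_transpose {a : ℕ} {F : Matrix (Fin a) (Fin a) ℂ} {z : ℂ} :
    z ∈ spectrum ℂ Fᵀ ↔ z ∈ spectrum ℂ F := by
  rw [spectrum.mem_iff, spectrum.mem_iff, ← Matrix.isUnit_transpose]
  simp [Algebra.algebraMap_eq_smul_one]

theorem IsHurwitz.transpose {n : ℕ} {A : Matrix (Fin n) (Fin n) ℝ} (hA : IsHurwitz A) :
    IsHurwitz Aᵀ := fun z hz => hA z (mem_spectrum_transpose.mp hz)

theorem toComplexMatrix_mul {a b c : ℕ} (M : Matrix (Fin a) (Fin b) ℝ)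
    (N : Matrix (Fin b) (Fin c) ℝ) :
    toComplexMatrix (M * N) = toComplexMatrix M * toComplexMatrix N :=
  Matrix.map_mul (f := Complex.ofRealHom)

theorem toComplexMatrix_add {a b : ℕ} (M N : Matrix (Fin a) (Fin b) ℝ) :
    toComplexMatrix (M + N) = toComplexMatrix M + toComplexMatrix N := by
  ext i j; simp [toComplexMatrix]

theorem toComplexMatrix_sub {a b : ℕ} (M N : Matrix (Fin a) (Fin b) ℝ) :
    toComplexMatrix (M - N) = toComplexMatrix M - toComplexMatrix N := by
  ext i j; simp [toComplexMatrix]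

theorem toComplexMatrix_zero {a b : ℕ} :
    toComplexMatrix (0 : Matrix (Fin a) (Fin b) ℝ) = 0 := by
  ext i j; simp [toComplexMatrix]

theorem toComplexMatrix_neg {a b : ℕ} (M : Matrix (Fin a) (Fin b) ℝ) :
    toComplexMatrix (-M) = -toComplexMatrix M := by
  ext i j; simp [toComplexMatrix]

theorem conjTranspose_toComplexMatrix {a b : ℕ} (M : Matrix (Fin a) (Fin b) ℝ) :
    (toComplexMatrix M)ᴴ = toComplexMatrix Mᵀ := by
  ext i j; simp [toComplexMatrix]

theorem toComplexMatrix_injective {a b : ℕ} :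
    Function.Injective (toComplexMatrix (a := a) (b := b)) :=
  Matrix.map_injective Complex.ofReal_injective

/-- The Sylvester operator of two Hurwitz matrices is injective. -/
theorem IsHurwitz.eq_zero_of_sylvester {a b : ℕ} {F : Matrix (Fin a) (Fin a) ℝ}
    {G : Matrix (Fin b) (Fin b) ℝ} (hF : IsHurwitz F) (hG : IsHurwitz G)
    {X : Matrix (Fin a) (Fin b) ℝ} (h : F * X + X * G = 0) : X = 0 := by
  by_contra hX
  -- Left multiplication by F and right multiplication by G commute. A common eigenvector in the
  -- kernel of their sum gives eigenvalues s of F and t of G with s + t = 0, impossible when both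
  -- have negative real part.
  let f : Module.End ℂ (Matrix (Fin a) (Fin b) ℂ) := mulLeftLinearMap (Fin b) ℂ (toComplexMatrix F)
  let g : Module.End ℂ (Matrix (Fin a) (Fin b) ℂ) := mulRightLinearMap (Fin a) ℂ (toComplexMatrix G)
  have hf : ∀ Y, f Y = toComplexMatrix F * Y := fun Y => rfl
  have hg : ∀ Y, g Y = Y * toComplexMatrix G := fun Y => rfl
  have hfg : ∀ Y, f (g Y) = g (f Y) := fun Y => by simp only [hf, hg, Matrix.mul_assoc]
  have hker : LinearMap.ker (f + g) ≠ ⊥ := by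
    refine (Submodule.ne_bot_iff _).mpr ⟨toComplexMatrix X, ?_, ?_⟩
    · have := congrArg toComplexMatrix h
      rwa [toComplexMatrix_add, toComplexMatrix_mul, toComplexMatrix_mul,
        toComplexMatrix_zero] at this
    · exact fun h0 => hX (toComplexMatrix_injective (h0.trans toComplexMatrix_zero.symm))
  obtain ⟨Y, hY, hY0, s, t, hs, ht⟩ := Module.End.exists_common_eigenvector_mem_of_invariant f g
    hfg hker (fun w hw => by
      have hw' : f w + g w = 0 := hw
      change f (f w) + g (f w) = 0
      rw [← hfg, ← map_add, hw', map_zero]) (fun w hw => by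
      have hw' : f w + g w = 0 := hw
      change f (g w) + g (g w) = 0
      rw [hfg, ← map_add, hw', map_zero])
  have hY' : f Y + g Y = 0 := hY
  rw [hs, ht, ← add_smul] at hY'
  have hst : s + t = 0 := (smul_eq_zero.mp hY').resolve_right hY0
  have h1 := hF s (mem_spectrum_of_mul_eq_smul hY0 hs)
  have h2 : (toComplexMatrix G)ᵀ * Yᵀ = t • Yᵀ := by
    rw [← Matrix.transpose_mul, ← Matrix.transpose_smul]
    exact congrArg Matrix.transpose ht
  have h3 := hG t (mem_spectrum_transpose.mp (mem_spectrum_of_mul_eq_smul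
    (fun h0 => hY0 (Matrix.transpose_injective h0)) h2))
  have h4 := congrArg Complex.re hst
  simp only [Complex.add_re, Complex.zero_re] at h4
  linarith

theorem IsHurwitz.solvesSylvester_unique {a b : ℕ} {F : Matrix (Fin a) (Fin a) ℝ}
    {G : Matrix (Fin b) (Fin b) ℝ} (hF : IsHurwitz F) (hG : IsHurwitz G)
    {H X Y : Matrix (Fin a) (Fin b) ℝ} (hX : SolvesSylvester F G H X)
    (hY : SolvesSylvester F G H Y) : X = Y := by
  refine sub_eq_zero.mp (hF.eq_zero_of_sylvester hG ?_)
  have h1 : F * X + X * G + H = 0 := hX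
  have h2 : F * Y + Y * G + H = 0 := hY
  rw [Matrix.mul_sub, Matrix.sub_mul]
  calc _ = (F * X + X * G + H) - (F * Y + Y * G + H) := by abel
    _ = 0 := by rw [h1, h2, sub_zero]

theorem IsHurwitz.existsUnique_solvesSylvester {a b : ℕ} {F : Matrix (Fin a) (Fin a) ℝ}
    {G : Matrix (Fin b) (Fin b) ℝ} (hF : IsHurwitz F) (hG : IsHurwitz G)
    (H : Matrix (Fin a) (Fin b) ℝ) : ∃! X, SolvesSylvester F G H X := by
  let T : Matrix (Fin a) (Fin b) ℝ →ₗ[ℝ] Matrix (Fin a) (Fin b) ℝ :=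
    mulLeftLinearMap (Fin b) ℝ F + mulRightLinearMap (Fin a) ℝ G
  have hT : ∀ X, T X = F * X + X * G := fun X => rfl
  have hinj : Function.Injective T := (injective_iff_map_eq_zero _).mpr fun X hX =>
    hF.eq_zero_of_sylvester hG hX
  obtain ⟨X, hX⟩ := LinearMap.injective_iff_surjective.mp hinj (-H)
  have hX' : SolvesSylvester F G H X := by
    change F * X + X * G + H = 0
    rw [← hT, hX, neg_add_cancel]
  exact ⟨X, hX', fun Y hY => hF.solvesSylvester_unique hG hY hX'⟩

end Sylvester

/-! ### Linearity of the band mean -/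

section BandMean

variable {a b c : ℕ} {ω : ℝ}

theorem ContinuousOn.matrixMul {s : Set ℝ} {F : ℝ → Matrix (Fin a) (Fin b) ℂ}
    {G : ℝ → Matrix (Fin b) (Fin c) ℂ} (hF : ContinuousOn F s) (hG : ContinuousOn G s) :
    ContinuousOn (fun ν => F ν * G ν) s := by
  rw [continuousOn_iff_continuous_domRestrict] at *
  exact hF.matrix_mul hG

theorem ContinuousOn.matrixConjTranspose {s : Set ℝ} {F : ℝ → Matrix (Fin a) (Fin b) ℂ}
    (hF : ContinuousOn F s) : ContinuousOn (fun ν => (F ν)ᴴ) s := by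
  rw [continuousOn_iff_continuous_domRestrict] at *
  exact hF.matrix_conjTranspose

theorem intervalIntegrable_re_apply (hω : 0 ≤ ω) {F : ℝ → Matrix (Fin a) (Fin b) ℂ}
    (hF : ContinuousOn F (Icc (-ω) ω)) (i j) :
    IntervalIntegrable (fun ν => (F ν i j).re) volume (-ω) ω := by
  refine ContinuousOn.intervalIntegrable_of_Icc (by linarith) ?_
  exact (Complex.continuous_re.comp (continuous_id.matrix_elem i j)).comp_continuousOn hF

theorem bandMean_congr (hω : 0 ≤ ω) {F G : ℝ → Matrix (Fin a) (Fin b) ℂ}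
    (h : ∀ ν ∈ Icc (-ω) ω, F ν = G ν) : bandMean ω F = bandMean ω G := by
  ext i j
  simp only [bandMean, Matrix.of_apply]
  congr 1
  refine intervalIntegral.integral_congr fun ν hν => ?_
  rw [uIcc_of_le (by linarith)] at hν
  simp only [h ν hν]

theorem bandMean_add (hω : 0 ≤ ω) {F G : ℝ → Matrix (Fin a) (Fin b) ℂ}
    (hF : ContinuousOn F (Icc (-ω) ω)) (hG : ContinuousOn G (Icc (-ω) ω)) :
    bandMean ω (fun ν => F ν + G ν) = bandMean ω F + bandMean ω G := by
  ext i j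
  simp only [bandMean, Matrix.of_apply, Matrix.add_apply, Complex.add_re]
  rw [intervalIntegral.integral_add (intervalIntegrable_re_apply hω hF i j)
    (intervalIntegrable_re_apply hω hG i j), mul_add]

theorem bandMean_neg (F : ℝ → Matrix (Fin a) (Fin b) ℂ) :
    bandMean ω (fun ν => -F ν) = -bandMean ω F := by
  ext i j
  simp only [bandMean, Matrix.of_apply, Matrix.neg_apply, Complex.neg_re,
    intervalIntegral.integral_neg, mul_neg]

theorem bandMean_sub (hω : 0 ≤ ω) {F G : ℝ → Matrix (Fin a) (Fin b) ℂ}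
    (hF : ContinuousOn F (Icc (-ω) ω)) (hG : ContinuousOn G (Icc (-ω) ω)) :
    bandMean ω (fun ν => F ν - G ν) = bandMean ω F - bandMean ω G := by
  simp only [sub_eq_add_neg]
  rw [← bandMean_neg]
  exact bandMean_add hω hF hG.neg

theorem bandMean_conjTranspose (F : ℝ → Matrix (Fin a) (Fin b) ℂ) :
    bandMean ω (fun ν => (F ν)ᴴ) = (bandMean ω F)ᵀ := by
  ext i j
  simp [bandMean]

/-- A constant factor passes through the real part because it is real. Complex factors such as iν
must therefore cancel inside the integrand. -/
theorem bandMean_const_mul (hω : 0 ≤ ω) (K : Matrix (Fin a) (Fin b) ℝ)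
    {F : ℝ → Matrix (Fin b) (Fin c) ℂ} (hF : ContinuousOn F (Icc (-ω) ω)) :
    bandMean ω (fun ν => toComplexMatrix K * F ν) = K * bandMean ω F := by
  ext i j
  simp only [bandMean, Matrix.of_apply, Matrix.mul_apply, toComplexMatrix, Matrix.map_apply,
    Complex.re_sum, Complex.re_ofReal_mul]
  rw [intervalIntegral.integral_finsetSum fun k _ =>
    (intervalIntegrable_re_apply hω hF k j).const_mul _, Finset.mul_sum]
  refine Finset.sum_congr rfl fun k _ => ?_
  rw [intervalIntegral.integral_const_mul]
  ring

theorem bandMean_mul_const (hω : 0 ≤ ω) (K : Matrix (Fin b) (Fin c) ℝ)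
    {F : ℝ → Matrix (Fin a) (Fin b) ℂ} (hF : ContinuousOn F (Icc (-ω) ω)) :
    bandMean ω (fun ν => F ν * toComplexMatrix K) = bandMean ω F * K := by
  ext i j
  simp only [bandMean, Matrix.of_apply, Matrix.mul_apply, toComplexMatrix, Matrix.map_apply,
    Complex.re_sum, Complex.re_mul_ofReal]
  rw [intervalIntegral.integral_finsetSum fun k _ =>
    (intervalIntegrable_re_apply hω hF i k).mul_const _, Finset.mul_sum]
  refine Finset.sum_congr rfl fun k _ => ?_
  rw [intervalIntegral.integral_mul_const]
  ring

theorem bandMean_const (K : Matrix (Fin a) (Fin b) ℝ) :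
    bandMean ω (fun _ => toComplexMatrix K) = (ω / Real.pi) • K := by
  ext i j
  simp only [bandMean, Matrix.of_apply, toComplexMatrix, Matrix.map_apply, Complex.ofReal_re,
    intervalIntegral.integral_const, smul_eq_mul, Matrix.smul_apply]
  field_simp
  ring

theorem trace_bandMean (hω : 0 ≤ ω) {F : ℝ → Matrix (Fin a) (Fin a) ℂ}
    (hF : ContinuousOn F (Icc (-ω) ω)) :
    (bandMean ω F).trace = 1 / (2 * Real.pi) * ∫ ν in (-ω)..ω, (F ν).trace.re := by
  simp only [Matrix.trace, bandMean, Matrix.diag_apply, Matrix.of_apply, Complex.re_sum]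
  rw [intervalIntegral.integral_finsetSum fun k _ => intervalIntegrable_re_apply hω hF k k,
    Finset.mul_sum]

end BandMean

end

/-! ### Entrywise calculus for resolvents, and the derivative of the logarithm -/

section

open Set Filter Topology MeasureTheory
open scoped Interval Matrix

/-- Differentiation under the integral sign over a compact interval, with the derivative expressed
through directional derivatives of the integrand. -/
theorem exists_hasFDerivAt_intervalIntegral {H : Type*} [NormedAddCommGroup H] [NormedSpace ℝ H]
    {a b : ℝ} (hab : a ≤ b) {F : H × ℝ → ℝ} {x₀ : H}
    (hF : ∀ t ∈ Icc a b, ContDiffAt ℝ 1 F (x₀, t)) :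
    ∃ L : H →L[ℝ] ℝ, HasFDerivAt (fun x => ∫ t in a..b, F (x, t)) L x₀ ∧
      ∀ (h : H) (D : ℝ → ℝ),
        (∀ t ∈ Icc a b, HasDerivAt (fun s : ℝ => F (x₀ + s • h, t)) (D t) 0) →
        L h = ∫ t in a..b, D t := by
  obtain ⟨hc, hd⟩ := hasFDerivAt_intervalIntegral_of_contDiffAt (𝕜 := ℝ) hab hF
  refine ⟨_, hd, fun h D hD => ?_⟩
  rw [ContinuousLinearMap.intervalIntegral_apply (hc.intervalIntegrable_of_Icc hab)]
  refine intervalIntegral.integral_congr fun t ht => ?_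
  rw [uIcc_of_le hab] at ht
  have h1 := ((hF t ht).differentiableAt (by simp)).hasFDerivAt
  have h2 : HasDerivAt (fun s : ℝ => (x₀ + s • h, t)) (h, (0 : ℝ)) 0 := by
    have := ((hasDerivAt_id (0 : ℝ)).smul_const h).const_add x₀
    simp only [id_eq, one_smul] at this
    exact this.prodMk (hasDerivAt_const _ _)
  have h1' : HasFDerivAt F (fderiv ℝ F (x₀, t)) (x₀ + (0 : ℝ) • h, t) := by simpa using h1
  exact (h1'.comp_hasDerivAt (0 : ℝ) h2).unique (hD t ht)

section EntrywiseCalculus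

variable {Z : Type*} [NormedAddCommGroup Z] [NormedSpace ℝ Z] {a b c : ℕ}

/-- All entries of the matrix-valued function `M` are continuously differentiable at `z`. -/
def EntrywiseContDiffAt (M : Z → Matrix (Fin a) (Fin b) ℂ) (z : Z) : Prop :=
  ∀ i j, ContDiffAt ℝ 1 (fun y => M y i j) z

/-- The entries of the matrix-valued function `M` have the entries of `M'` as derivatives at `t`. -/
def EntrywiseHasDerivAt (M : ℝ → Matrix (Fin a) (Fin b) ℂ) (M' : Matrix (Fin a) (Fin b) ℂ)
    (t : ℝ) : Prop :=
  ∀ i j, HasDerivAt (fun s => M s i j) (M' i j) t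

theorem EntrywiseContDiffAt.mul {M : Z → Matrix (Fin a) (Fin b) ℂ}
    {N : Z → Matrix (Fin b) (Fin c) ℂ} {z : Z} (hM : EntrywiseContDiffAt M z)
    (hN : EntrywiseContDiffAt N z) : EntrywiseContDiffAt (fun y => M y * N y) z := by
  intro i j
  simp only [Matrix.mul_apply]
  exact ContDiffAt.sum fun k _ => (hM i k).mul (hN k j)

theorem EntrywiseContDiffAt.add {M N : Z → Matrix (Fin a) (Fin b) ℂ} {z : Z}
    (hM : EntrywiseContDiffAt M z) (hN : EntrywiseContDiffAt N z) :
    EntrywiseContDiffAt (fun y => M y + N y) z :=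
  fun i j => (hM i j).add (hN i j)

theorem EntrywiseContDiffAt.sub {M N : Z → Matrix (Fin a) (Fin b) ℂ} {z : Z}
    (hM : EntrywiseContDiffAt M z) (hN : EntrywiseContDiffAt N z) :
    EntrywiseContDiffAt (fun y => M y - N y) z :=
  fun i j => (hM i j).sub (hN i j)

theorem EntrywiseContDiffAt.conjTranspose {M : Z → Matrix (Fin a) (Fin b) ℂ} {z : Z}
    (hM : EntrywiseContDiffAt M z) : EntrywiseContDiffAt (fun y => (M y)ᴴ) z :=
  fun i j => Complex.conjCLE.contDiff.contDiffAt.comp z (hM j i)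

theorem EntrywiseContDiffAt.det {M : Z → Matrix (Fin a) (Fin a) ℂ} {z : Z}
    (hM : EntrywiseContDiffAt M z) : ContDiffAt ℝ 1 (fun y => (M y).det) z := by
  simp only [Matrix.det_apply']
  exact ContDiffAt.sum fun σ _ => contDiffAt_const.mul (contDiffAt_prod fun i _ => hM _ _)

/-- By Cramer's rule the entries of the inverse are determinants divided by the nonvanishing
determinant of M. -/
theorem EntrywiseContDiffAt.inv {M : Z → Matrix (Fin a) (Fin a) ℂ} {z : Z}
    (hM : EntrywiseContDiffAt M z) (hu : IsUnit (M z)) :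
    EntrywiseContDiffAt (fun y => (M y)⁻¹) z := by
  intro i j
  have hdet : (M z).det ≠ 0 := ((Matrix.isUnit_iff_isUnit_det _).mp hu).ne_zero
  simp only [Matrix.inv_def, Ring.inverse_eq_inv', Matrix.smul_apply, smul_eq_mul,
    Matrix.adjugate_apply]
  refine (hM.det.inv hdet).mul (EntrywiseContDiffAt.det fun k l => ?_)
  by_cases hk : k = j
  · subst hk
    simp only [Matrix.updateRow_self]
    exact contDiffAt_const
  · simp only [Matrix.updateRow_ne hk]
    exact hM k l

theorem EntrywiseContDiffAt.re_trace {M : Z → Matrix (Fin a) (Fin a) ℂ} {z : Z}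
    (hM : EntrywiseContDiffAt M z) : ContDiffAt ℝ 1 (fun y => (M y).trace.re) z := by
  have h1 : ContDiffAt ℝ 1 (fun y => (M y).trace) z := by
    simp only [Matrix.trace, Matrix.diag_apply]
    exact ContDiffAt.sum fun i _ => hM i i
  exact Complex.reCLM.contDiff.contDiffAt.comp z h1

theorem EntrywiseContDiffAt.toComplexMatrix {M : Z → Matrix (Fin a) (Fin b) ℝ} {z : Z}
    (hM : ∀ i j, ContDiffAt ℝ 1 (fun y => M y i j) z) :
    EntrywiseContDiffAt (fun y => toComplexMatrix (M y)) z :=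
  fun i j => Complex.ofRealCLM.contDiff.contDiffAt.comp z (hM i j)

theorem EntrywiseContDiffAt.freqResolvent {M : Z → Matrix (Fin a) (Fin a) ℝ} {f : Z → ℝ} {z : Z}
    (hM : ∀ i j, ContDiffAt ℝ 1 (fun y => M y i j) z) (hf : ContDiffAt ℝ 1 f z)
    (hu : IsUnit (shiftedMatrix (M z) (f z))) :
    EntrywiseContDiffAt (fun y => freqResolvent (M y) (f y)) z := by
  refine EntrywiseContDiffAt.inv (M := fun y => shiftedMatrix (M y) (f y)) (fun i j => ?_) hu
  have h1 : ContDiffAt ℝ 1 (fun y => (f y : ℂ)) z :=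
    Complex.ofRealCLM.contDiff.contDiffAt.comp z hf
  have h2 := EntrywiseContDiffAt.toComplexMatrix hM i j
  exact ((contDiffAt_const.mul h1).mul contDiffAt_const).sub h2

theorem EntrywiseHasDerivAt.mul {M : ℝ → Matrix (Fin a) (Fin b) ℂ} {M' : Matrix (Fin a) (Fin b) ℂ}
    {N : ℝ → Matrix (Fin b) (Fin c) ℂ} {N' : Matrix (Fin b) (Fin c) ℂ} {t : ℝ}
    (hM : EntrywiseHasDerivAt M M' t) (hN : EntrywiseHasDerivAt N N' t) :
    EntrywiseHasDerivAt (fun s => M s * N s) (M' * N t + M t * N') t := by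
  intro i j
  simp only [Matrix.mul_apply, Matrix.add_apply, ← Finset.sum_add_distrib]
  exact HasDerivAt.fun_sum fun k _ => (hM i k).mul (hN k j)

theorem EntrywiseHasDerivAt.add {M N : ℝ → Matrix (Fin a) (Fin b) ℂ}
    {M' N' : Matrix (Fin a) (Fin b) ℂ} {t : ℝ} (hM : EntrywiseHasDerivAt M M' t)
    (hN : EntrywiseHasDerivAt N N' t) : EntrywiseHasDerivAt (fun s => M s + N s) (M' + N') t :=
  fun i j => (hM i j).add (hN i j)

theorem EntrywiseHasDerivAt.const_sub {N : ℝ → Matrix (Fin a) (Fin b) ℂ}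
    {N' : Matrix (Fin a) (Fin b) ℂ} {t : ℝ} (M : Matrix (Fin a) (Fin b) ℂ)
    (hN : EntrywiseHasDerivAt N N' t) : EntrywiseHasDerivAt (fun s => M - N s) (-N') t :=
  fun i j => (hN i j).const_sub (M i j)

theorem EntrywiseHasDerivAt.conjTranspose {M : ℝ → Matrix (Fin a) (Fin b) ℂ}
    {M' : Matrix (Fin a) (Fin b) ℂ} {t : ℝ} (hM : EntrywiseHasDerivAt M M' t) :
    EntrywiseHasDerivAt (fun s => (M s)ᴴ) M'ᴴ t :=
  fun i j => Complex.conjCLE.hasFDerivAt.comp_hasDerivAt t (hM j i)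

theorem EntrywiseHasDerivAt.re_trace {M : ℝ → Matrix (Fin a) (Fin a) ℂ}
    {M' : Matrix (Fin a) (Fin a) ℂ} {t : ℝ} (hM : EntrywiseHasDerivAt M M' t) :
    HasDerivAt (fun s => (M s).trace.re) M'.trace.re t := by
  have h1 : HasDerivAt (fun s => (M s).trace) M'.trace t := by
    simp only [Matrix.trace, Matrix.diag_apply]
    exact HasDerivAt.fun_sum fun i _ => hM i i
  exact Complex.reCLM.hasFDerivAt.comp_hasDerivAt t h1

theorem entrywiseHasDerivAt_toComplexMatrix_line (M N : Matrix (Fin a) (Fin b) ℝ) (t : ℝ) :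
    EntrywiseHasDerivAt (fun s => toComplexMatrix (M + s • N)) (toComplexMatrix N) t := by
  intro i j
  have h1 : HasDerivAt (fun s : ℝ => M i j + s * N i j) (N i j) t := by
    simpa using ((hasDerivAt_id t).mul_const (N i j)).const_add (M i j)
  exact Complex.ofRealCLM.hasFDerivAt.comp_hasDerivAt t h1

theorem entrywiseHasDerivAt_freqResolvent_line {M : Matrix (Fin a) (Fin a) ℝ} {ν : ℝ}
    (hu : IsUnit (shiftedMatrix M ν)) (N : Matrix (Fin a) (Fin a) ℝ) :
    EntrywiseHasDerivAt (fun s => freqResolvent (M + s • N) ν)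
      (freqResolvent M ν * toComplexMatrix N * freqResolvent M ν) 0 := by
  have h1 : ∀ i j, HasDerivAt (fun s : ℝ => shiftedMatrix (M + s • N) ν i j)
      ((-toComplexMatrix N) i j) 0 := fun i j =>
    (entrywiseHasDerivAt_toComplexMatrix_line M N 0 i j).const_sub _
  intro i j
  have h2 := hasDerivAt_matrix_inv h1 (by simpa using hu) i j
  simp only [zero_smul, add_zero, Matrix.mul_neg, Matrix.neg_mul, neg_neg] at h2
  exact h2

end EntrywiseCalculus

section LogDerivative

attribute [local instance] Matrix.linftyOpNormedRing Matrix.linftyOpNormedAlgebra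

variable {n : ℕ}

/-- The derivative of the logarithm as an integral over the frequency band. -/
theorem re_logFrechet_eq_neg_bandMean {ω : ℝ} (hω : 0 ≤ ω) {A : Matrix (Fin n) (Fin n) ℝ}
    (hA : A ∈ bandDomain n ω) (N : Matrix (Fin n) (Fin n) ℝ) :
    ((Complex.I / (Real.pi : ℂ)) • logFrechet (negShift ω A) (toComplexMatrix N)).map Complex.re =
      -bandMean ω (fun ν => freqResolvent A ν * toComplexMatrix N * freqResolvent A ν) := by
  have hle : -ω ≤ ω := by linarith
  have hline : Continuous fun s : ℝ => A + s • N := by fun_prop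
  have hmem : ∀ᶠ s in 𝓝 (0 : ℝ), A + s • N ∈ bandDomain n ω :=
    hline.continuousAt.eventually ((isOpen_bandDomain ω).eventually_mem (by simpa using hA))
  have hshift : HasDerivAt (fun s : ℝ => negShift ω (A + s • N)) (-toComplexMatrix N) 0 := by
    refine hasDerivAt_matrix_iff.mpr fun i j => ?_
    exact ((entrywiseHasDerivAt_toComplexMatrix_line A N 0 i j).neg).sub_const _
  have hlog : HasFDerivAt (matrixLog (n := n)) (fderiv ℂ matrixLog (negShift ω A))
      (negShift ω (A + (0 : ℝ) • N)) := by
    simpa using (differentiableAt_matrixLog (negShift_mem_logDomain hω hA)).hasFDerivAt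
  have hcomp := (hlog.restrictScalars ℝ).comp_hasDerivAt (0 : ℝ) hshift
  ext i j
  -- The derivative of S_ω along A + sN is computed twice: here by the chain rule through the
  -- logarithm, whose argument moves in direction -N, and below (`h6`) under the integral of the
  -- resolvent. Uniqueness of derivatives equates the two.
  have h1 : HasDerivAt (fun s : ℝ => freqS ω (A + s • N) i j)
      (((Complex.I / (Real.pi : ℂ)) • fderiv ℂ matrixLog (negShift ω A)
        (-toComplexMatrix N)) i j).re 0 := by
    have h2 := hasDerivAt_matrix_iff.mp hcomp i j
    exact Complex.reCLM.hasFDerivAt.comp_hasDerivAt (0 : ℝ) (h2.const_mul _)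
  obtain ⟨L, hL, hLD⟩ := exists_hasFDerivAt_intervalIntegral (H := ℝ) hle (x₀ := 0)
    (F := fun q => (freqResolvent (A + q.1 • N) q.2 i j).re) (fun ν hν => by
      have h3 : EntrywiseContDiffAt (fun q : ℝ × ℝ => freqResolvent (A + q.1 • N) q.2) (0, ν) := by
        refine EntrywiseContDiffAt.freqResolvent (fun k l => ?_) contDiffAt_snd
          (by simpa using isUnit_shiftedMatrix hA hν)
        exact contDiffAt_const.add (contDiffAt_fst.mul contDiffAt_const)
      exact Complex.reCLM.contDiff.contDiffAt.comp _ (h3 i j))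
  have h4 := hLD 1 (fun ν => ((freqResolvent A ν * toComplexMatrix N * freqResolvent A ν) i j).re)
    (fun ν hν => by
      have h5 := entrywiseHasDerivAt_freqResolvent_line (isUnit_shiftedMatrix hA hν) N i j
      have h8 : HasDerivAt (fun s : ℝ => (freqResolvent (A + s • N) ν i j).re)
          ((freqResolvent A ν * toComplexMatrix N * freqResolvent A ν) i j).re 0 :=
        Complex.reCLM.hasFDerivAt.comp_hasDerivAt (0 : ℝ) h5
      simpa using h8)
  have h6 : HasDerivAt (fun s : ℝ => freqS ω (A + s • N) i j) (1 / (2 * Real.pi) * L 1) 0 := by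
    refine (hL.hasDerivAt.const_mul (1 / (2 * Real.pi))).congr_of_eventuallyEq ?_
    filter_upwards [hmem] with s hs
    rw [freqS_eq_bandMean hω hs]
    rfl
  have h7 := h1.unique h6
  rw [h4] at h7
  simp only [map_neg, smul_neg, Matrix.neg_apply, Complex.neg_re] at h7
  simp only [Matrix.map_apply, Matrix.neg_apply, bandMean, Matrix.of_apply, logFrechet]
  linarith

end LogDerivative

end

/-! ### Resolvent identities behind the Sylvester equations -/

section

open Set Filter Topology MeasureTheory
open scoped Interval Matrix

section BandIdentities

variable {a b : ℕ} {ω : ℝ}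

theorem toComplexMatrix_mul_freqResolvent {F : Matrix (Fin a) (Fin a) ℝ} {ν : ℝ}
    (hu : IsUnit (shiftedMatrix F ν)) :
    toComplexMatrix F * freqResolvent F ν = (Complex.I * (ν : ℂ)) • freqResolvent F ν - 1 := by
  have h1 : shiftedMatrix F ν * freqResolvent F ν = 1 :=
    Matrix.mul_nonsing_inv _ ((Matrix.isUnit_iff_isUnit_det _).mp hu)
  have h2 : toComplexMatrix F =
      (Complex.I * (ν : ℂ)) • (1 : Matrix (Fin a) (Fin a) ℂ) - shiftedMatrix F ν := by
    rw [shiftedMatrix, sub_sub_cancel]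
  rw [h2, Matrix.sub_mul, h1, Matrix.smul_mul, Matrix.one_mul]

theorem freqResolvent_mul_toComplexMatrix {F : Matrix (Fin a) (Fin a) ℝ} {ν : ℝ}
    (hu : IsUnit (shiftedMatrix F ν)) :
    freqResolvent F ν * toComplexMatrix F = (Complex.I * (ν : ℂ)) • freqResolvent F ν - 1 := by
  have h1 : freqResolvent F ν * shiftedMatrix F ν = 1 :=
    Matrix.nonsing_inv_mul _ ((Matrix.isUnit_iff_isUnit_det _).mp hu)
  have h2 : toComplexMatrix F =
      (Complex.I * (ν : ℂ)) • (1 : Matrix (Fin a) (Fin a) ℂ) - shiftedMatrix F ν := by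
    rw [shiftedMatrix, sub_sub_cancel]
  rw [h2, Matrix.mul_sub, h1, Matrix.mul_smul, Matrix.mul_one]

theorem conjTranspose_freqResolvent_mul {F : Matrix (Fin a) (Fin a) ℝ} {ν : ℝ}
    (hu : IsUnit (shiftedMatrix F ν)) :
    (freqResolvent F ν)ᴴ * toComplexMatrix Fᵀ =
      -((Complex.I * (ν : ℂ)) • (freqResolvent F ν)ᴴ) - 1 := by
  have h := congrArg Matrix.conjTranspose (toComplexMatrix_mul_freqResolvent hu)
  rw [Matrix.conjTranspose_mul, conjTranspose_toComplexMatrix, Matrix.conjTranspose_sub,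
    Matrix.conjTranspose_smul, Matrix.conjTranspose_one] at h
  rw [h]
  simp

theorem mul_conjTranspose_freqResolvent {F : Matrix (Fin a) (Fin a) ℝ} {ν : ℝ}
    (hu : IsUnit (shiftedMatrix F ν)) :
    toComplexMatrix Fᵀ * (freqResolvent F ν)ᴴ =
      -((Complex.I * (ν : ℂ)) • (freqResolvent F ν)ᴴ) - 1 := by
  have h := congrArg Matrix.conjTranspose (freqResolvent_mul_toComplexMatrix hu)
  rw [Matrix.conjTranspose_mul, conjTranspose_toComplexMatrix, Matrix.conjTranspose_sub,
    Matrix.conjTranspose_smul, Matrix.conjTranspose_one] at h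
  rw [h]
  simp

theorem continuousOn_toComplexMatrix_const {s : Set ℝ} (K : Matrix (Fin a) (Fin b) ℝ) :
    ContinuousOn (fun _ : ℝ => toComplexMatrix K) s :=
  continuousOn_const

/-- The band-limited reachability-type integral solves its Sylvester equation. -/
theorem solvesSylvester_bandMean_mul_conjTranspose (hω : 0 ≤ ω) {F : Matrix (Fin a) (Fin a) ℝ}
    {G : Matrix (Fin b) (Fin b) ℝ} (hF : F ∈ bandDomain a ω) (hG : G ∈ bandDomain b ω)
    (H : Matrix (Fin a) (Fin b) ℝ) :
    SolvesSylvester F Gᵀ (freqS ω F * H + H * (freqS ω G)ᵀ)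
      (bandMean ω fun ν => freqResolvent F ν * toComplexMatrix H * (freqResolvent G ν)ᴴ) := by
  have hcF := continuousOn_freqResolvent hF
  have hcG := (continuousOn_freqResolvent hG).matrixConjTranspose
  have hcFH := hcF.matrixMul (continuousOn_toComplexMatrix_const H)
  have hc := hcFH.matrixMul hcG
  have hcHG := (continuousOn_toComplexMatrix_const H).matrixMul hcG
  rw [freqS_eq_bandMean hω hF, freqS_eq_bandMean hω hG, SolvesSylvester,
    ← bandMean_const_mul hω _ hc, ← bandMean_mul_const hω _ hc, ← bandMean_mul_const hω _ hcF,
    ← bandMean_conjTranspose, ← bandMean_const_mul hω _ hcG,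
    ← bandMean_add hω ((continuousOn_toComplexMatrix_const F).matrixMul hc)
      (hc.matrixMul (continuousOn_toComplexMatrix_const Gᵀ)),
    ← bandMean_add hω hcFH hcHG, add_eq_zero_iff_eq_neg, ← bandMean_neg]
  refine bandMean_congr hω fun ν hν => ?_
  -- The left factor F yields iνR - 1 and the right factor Gᵀ yields -iνRᴴ - 1, so the iν terms
  -- cancel and what is left is minus the inhomogeneity.
  have h1 := toComplexMatrix_mul_freqResolvent (isUnit_shiftedMatrix hF hν)
  have h2 := conjTranspose_freqResolvent_mul (isUnit_shiftedMatrix hG hν)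
  rw [← Matrix.mul_assoc, ← Matrix.mul_assoc, h1, Matrix.mul_assoc (_ * _), h2]
  simp only [Matrix.sub_mul, Matrix.mul_sub, Matrix.mul_neg, Matrix.smul_mul, Matrix.mul_smul,
    Matrix.one_mul, Matrix.mul_one]
  abel

/-- The band-limited observability-type integral solves its Sylvester equation. -/
theorem solvesSylvester_bandMean_conjTranspose_mul (hω : 0 ≤ ω) {F : Matrix (Fin a) (Fin a) ℝ}
    {G : Matrix (Fin b) (Fin b) ℝ} (hF : F ∈ bandDomain a ω) (hG : G ∈ bandDomain b ω)
    (H : Matrix (Fin a) (Fin b) ℝ) :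
    SolvesSylvester Fᵀ G ((freqS ω F)ᵀ * H + H * freqS ω G)
      (bandMean ω fun ν => (freqResolvent F ν)ᴴ * toComplexMatrix H * freqResolvent G ν) := by
  have hcF := (continuousOn_freqResolvent hF).matrixConjTranspose
  have hcG := continuousOn_freqResolvent hG
  have hcFH := hcF.matrixMul (continuousOn_toComplexMatrix_const H)
  have hc := hcFH.matrixMul hcG
  have hcHG := (continuousOn_toComplexMatrix_const H).matrixMul hcG
  rw [freqS_eq_bandMean hω hF, freqS_eq_bandMean hω hG, SolvesSylvester,
    ← bandMean_const_mul hω _ hc, ← bandMean_mul_const hω _ hc, ← bandMean_conjTranspose,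
    ← bandMean_mul_const hω _ hcF, ← bandMean_const_mul hω _ hcG,
    ← bandMean_add hω ((continuousOn_toComplexMatrix_const Fᵀ).matrixMul hc)
      (hc.matrixMul (continuousOn_toComplexMatrix_const G)),
    ← bandMean_add hω hcFH hcHG, add_eq_zero_iff_eq_neg, ← bandMean_neg]
  refine bandMean_congr hω fun ν hν => ?_
  have h1 := mul_conjTranspose_freqResolvent (isUnit_shiftedMatrix hF hν)
  have h2 := freqResolvent_mul_toComplexMatrix (isUnit_shiftedMatrix hG hν)
  rw [← Matrix.mul_assoc, ← Matrix.mul_assoc, h1, Matrix.mul_assoc (_ * _), h2]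
  simp only [Matrix.sub_mul, Matrix.mul_sub, Matrix.neg_mul, Matrix.smul_mul, Matrix.mul_smul,
    Matrix.one_mul, Matrix.mul_one]
  abel

theorem SolvesSylvester.transpose {F : Matrix (Fin a) (Fin a) ℝ} {G : Matrix (Fin b) (Fin b) ℝ}
    {H X : Matrix (Fin a) (Fin b) ℝ} (h : SolvesSylvester F G H X) :
    SolvesSylvester Gᵀ Fᵀ Hᵀ Xᵀ := by
  have h1 := congrArg Matrix.transpose (show F * X + X * G + H = 0 from h)
  simp only [Matrix.transpose_add, Matrix.transpose_mul, Matrix.transpose_zero] at h1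
  rw [SolvesSylvester, add_comm (Gᵀ * Xᵀ)]
  exact h1

/-- A solution of a Sylvester equation turns a product of resolvents into a sum. -/
theorem SolvesSylvester.freqResolvent_mul_mul_conjTranspose {F : Matrix (Fin a) (Fin a) ℝ}
    {G : Matrix (Fin b) (Fin b) ℝ} {H X : Matrix (Fin a) (Fin b) ℝ}
    (h : SolvesSylvester F Gᵀ H X) {ν : ℝ} (hF : IsUnit (shiftedMatrix F ν))
    (hG : IsUnit (shiftedMatrix G ν)) :
    freqResolvent F ν * toComplexMatrix H * (freqResolvent G ν)ᴴ =
      toComplexMatrix X * (freqResolvent G ν)ᴴ + freqResolvent F ν * toComplexMatrix X := by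
  have h1 : H = -(F * X + X * Gᵀ) := (neg_eq_of_add_eq_zero_right h).symm
  have h2 := freqResolvent_mul_toComplexMatrix hF
  have h3 := mul_conjTranspose_freqResolvent hG
  rw [h1, toComplexMatrix_neg, toComplexMatrix_add, toComplexMatrix_mul, toComplexMatrix_mul]
  simp only [Matrix.mul_neg, Matrix.neg_mul, Matrix.mul_add, Matrix.add_mul]
  rw [← Matrix.mul_assoc (freqResolvent F ν), h2]
  rw [Matrix.mul_assoc (freqResolvent F ν), Matrix.mul_assoc (toComplexMatrix X), h3]
  simp only [Matrix.sub_mul, Matrix.mul_sub, Matrix.mul_neg, Matrix.smul_mul, Matrix.mul_smul,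
    Matrix.one_mul, Matrix.mul_one, Matrix.mul_assoc]
  abel

theorem trace_bandMean_comm (hω : 0 ≤ ω) {F : ℝ → Matrix (Fin a) (Fin b) ℂ}
    {G : ℝ → Matrix (Fin b) (Fin a) ℂ} (hF : ContinuousOn F (Icc (-ω) ω))
    (hG : ContinuousOn G (Icc (-ω) ω)) :
    (bandMean ω fun ν => F ν * G ν).trace = (bandMean ω fun ν => G ν * F ν).trace := by
  rw [trace_bandMean hω (hF.matrixMul hG), trace_bandMean hω (hG.matrixMul hF)]
  simp only [fun ν => Matrix.trace_mul_comm (F ν) (G ν)]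

end BandIdentities

end

/-! ### Differentiability of the cost -/

section

open Set Filter Topology MeasureTheory
open scoped Interval Matrix

section CostGradient

attribute [local instance] Matrix.normedAddCommGroup Matrix.normedSpace

variable {n r m p : ℕ} {ω : ℝ}

theorem transferFunction_eq_freqResolvent (A : Matrix (Fin n) (Fin n) ℝ)
    (B : Matrix (Fin n) (Fin m) ℝ) (C : Matrix (Fin p) (Fin n) ℝ) (D : Matrix (Fin p) (Fin m) ℝ)
    (ν : ℝ) : transferFunction A B C D ν =
      toComplexMatrix C * freqResolvent A ν * toComplexMatrix B + toComplexMatrix D := rfl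

/-- The derivative of the transfer function in its four matrices. -/
noncomputable def transferDeriv (A : Matrix (Fin r) (Fin r) ℝ) (B : Matrix (Fin r) (Fin m) ℝ)
    (C : Matrix (Fin p) (Fin r) ℝ) (a : Matrix (Fin r) (Fin r) ℝ) (b : Matrix (Fin r) (Fin m) ℝ)
    (c : Matrix (Fin p) (Fin r) ℝ) (d : Matrix (Fin p) (Fin m) ℝ) (ν : ℝ) :
    Matrix (Fin p) (Fin m) ℂ :=
  toComplexMatrix c * freqResolvent A ν * toComplexMatrix B
    + toComplexMatrix C * (freqResolvent A ν * toComplexMatrix a * freqResolvent A ν)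
      * toComplexMatrix B
    + toComplexMatrix C * freqResolvent A ν * toComplexMatrix b + toComplexMatrix d

theorem entrywiseHasDerivAt_transferFunction_line {A : Matrix (Fin r) (Fin r) ℝ} {ν : ℝ}
    (hu : IsUnit (shiftedMatrix A ν)) (B : Matrix (Fin r) (Fin m) ℝ)
    (C : Matrix (Fin p) (Fin r) ℝ) (D : Matrix (Fin p) (Fin m) ℝ)
    (a : Matrix (Fin r) (Fin r) ℝ) (b : Matrix (Fin r) (Fin m) ℝ)
    (c : Matrix (Fin p) (Fin r) ℝ) (d : Matrix (Fin p) (Fin m) ℝ) :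
    EntrywiseHasDerivAt
      (fun s => transferFunction (A + s • a) (B + s • b) (C + s • c) (D + s • d) ν)
      (transferDeriv A B C a b c d ν) 0 := by
  have h1 := (((entrywiseHasDerivAt_toComplexMatrix_line C c 0).mul
    (entrywiseHasDerivAt_freqResolvent_line hu a)).mul
    (entrywiseHasDerivAt_toComplexMatrix_line B b 0)).add
    (entrywiseHasDerivAt_toComplexMatrix_line D d 0)
  simp only [zero_smul, add_zero, Matrix.add_mul] at h1
  exact h1

theorem continuousOn_transferFunction {A : Matrix (Fin n) (Fin n) ℝ} (hA : A ∈ bandDomain n ω)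
    (B : Matrix (Fin n) (Fin m) ℝ) (C : Matrix (Fin p) (Fin n) ℝ) (D : Matrix (Fin p) (Fin m) ℝ) :
    ContinuousOn (transferFunction A B C D) (Icc (-ω) ω) :=
  (((continuousOn_toComplexMatrix_const C).matrixMul (continuousOn_freqResolvent hA)).matrixMul
    (continuousOn_toComplexMatrix_const B)).add (continuousOn_toComplexMatrix_const D)

theorem continuousOn_transferDeriv {A : Matrix (Fin r) (Fin r) ℝ} (hA : A ∈ bandDomain r ω)
    (B : Matrix (Fin r) (Fin m) ℝ) (C : Matrix (Fin p) (Fin r) ℝ)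
    (a : Matrix (Fin r) (Fin r) ℝ) (b : Matrix (Fin r) (Fin m) ℝ)
    (c : Matrix (Fin p) (Fin r) ℝ) (d : Matrix (Fin p) (Fin m) ℝ) :
    ContinuousOn (transferDeriv A B C a b c d) (Icc (-ω) ω) := by
  have hR := continuousOn_freqResolvent hA
  have hK : ∀ {k l : ℕ} (K : Matrix (Fin k) (Fin l) ℝ),
      ContinuousOn (fun _ : ℝ => toComplexMatrix K) (Icc (-ω) ω) :=
    fun K => continuousOn_toComplexMatrix_const K
  exact (((((hK c).matrixMul hR).matrixMul (hK B)).add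
    (((hK C).matrixMul ((hR.matrixMul (hK a)).matrixMul hR)).matrixMul (hK B))).add
    (((hK C).matrixMul hR).matrixMul (hK b))).add (hK d)

theorem entrywiseContDiffAt_transferFunction {Z : Type*} [NormedAddCommGroup Z] [NormedSpace ℝ Z]
    {A : Z → Matrix (Fin r) (Fin r) ℝ} {B : Z → Matrix (Fin r) (Fin m) ℝ}
    {C : Z → Matrix (Fin p) (Fin r) ℝ} {D : Z → Matrix (Fin p) (Fin m) ℝ} {f : Z → ℝ} {z : Z}
    (hA : ∀ i j, ContDiffAt ℝ 1 (fun y => A y i j) z)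
    (hB : ∀ i j, ContDiffAt ℝ 1 (fun y => B y i j) z)
    (hC : ∀ i j, ContDiffAt ℝ 1 (fun y => C y i j) z)
    (hD : ∀ i j, ContDiffAt ℝ 1 (fun y => D y i j) z) (hf : ContDiffAt ℝ 1 f z)
    (hu : IsUnit (shiftedMatrix (A z) (f z))) :
    EntrywiseContDiffAt (fun y => transferFunction (A y) (B y) (C y) (D y) (f y)) z :=
  (((EntrywiseContDiffAt.toComplexMatrix hC).mul (EntrywiseContDiffAt.freqResolvent hA hf hu)).mul
    (EntrywiseContDiffAt.toComplexMatrix hB)).add (EntrywiseContDiffAt.toComplexMatrix hD)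

theorem contDiffAt_matrix_entry {Z : Type*} [NormedAddCommGroup Z] [NormedSpace ℝ Z] {a b : ℕ}
    {M : Z → Matrix (Fin a) (Fin b) ℝ} {z : Z} (hM : ContDiffAt ℝ 1 M z) (i j) :
    ContDiffAt ℝ 1 (fun y => M y i j) z :=
  contDiffAt_pi.mp (contDiffAt_pi.mp hM i) j

/-- The cost is differentiable in the matrices of the reduced system. -/
theorem exists_hasFDerivAt_errorCost (hω : 0 ≤ ω) {A : Matrix (Fin n) (Fin n) ℝ}
    (hA : A ∈ bandDomain n ω) (B : Matrix (Fin n) (Fin m) ℝ)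
    (C : Matrix (Fin p) (Fin n) ℝ) (D : Matrix (Fin p) (Fin m) ℝ)
    {A' : Matrix (Fin r) (Fin r) ℝ} (hA' : A' ∈ bandDomain r ω) (B' : Matrix (Fin r) (Fin m) ℝ)
    (C' : Matrix (Fin p) (Fin r) ℝ) (D' : Matrix (Fin p) (Fin m) ℝ) :
    ∃ L : (Matrix (Fin r) (Fin r) ℝ × Matrix (Fin r) (Fin m) ℝ ×
        Matrix (Fin p) (Fin r) ℝ × Matrix (Fin p) (Fin m) ℝ) →L[ℝ] ℝ,
      HasFDerivAt (fun y : Matrix (Fin r) (Fin r) ℝ × Matrix (Fin r) (Fin m) ℝ ×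
          Matrix (Fin p) (Fin r) ℝ × Matrix (Fin p) (Fin m) ℝ =>
        errorCost ω A B C D y.1 y.2.1 y.2.2.1 y.2.2.2) L (A', B', C', D') ∧
      ∀ a b c d, L (a, b, c, d) = -2 * (bandMean ω fun ν => transferDeriv A' B' C' a b c d ν *
        (transferFunction A B C D ν - transferFunction A' B' C' D' ν)ᴴ).trace := by
  have hle : -ω ≤ ω := by linarith
  obtain ⟨L, hL, hLD⟩ := exists_hasFDerivAt_intervalIntegral
    (H := Matrix (Fin r) (Fin r) ℝ × Matrix (Fin r) (Fin m) ℝ ×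
        Matrix (Fin p) (Fin r) ℝ × Matrix (Fin p) (Fin m) ℝ) hle (x₀ := (A', B', C', D'))
    (F := fun q => (((transferFunction A B C D q.2 -
        transferFunction q.1.1 q.1.2.1 q.1.2.2.1 q.1.2.2.2 q.2) *
      (transferFunction A B C D q.2 -
        transferFunction q.1.1 q.1.2.1 q.1.2.2.1 q.1.2.2.2 q.2)ᴴ).trace).re) (fun ν hν => by
      have h1 := entrywiseContDiffAt_transferFunction
        (Z := (Matrix (Fin r) (Fin r) ℝ × Matrix (Fin r) (Fin m) ℝ ×
          Matrix (Fin p) (Fin r) ℝ × Matrix (Fin p) (Fin m) ℝ) × ℝ)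
        (A := fun q => q.1.1) (B := fun q => q.1.2.1) (C := fun q => q.1.2.2.1)
        (D := fun q => q.1.2.2.2) (f := fun q => q.2) (z := ((A', B', C', D'), ν))
        (contDiffAt_matrix_entry (by fun_prop)) (contDiffAt_matrix_entry (by fun_prop))
        (contDiffAt_matrix_entry (by fun_prop)) (contDiffAt_matrix_entry (by fun_prop))
        (by fun_prop) (isUnit_shiftedMatrix hA' hν)
      have h2 := entrywiseContDiffAt_transferFunction
        (Z := (Matrix (Fin r) (Fin r) ℝ × Matrix (Fin r) (Fin m) ℝ ×
          Matrix (Fin p) (Fin r) ℝ × Matrix (Fin p) (Fin m) ℝ) × ℝ)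
        (A := fun q => A) (B := fun q => B) (C := fun q => C)
        (D := fun q => D) (f := fun q => q.2) (z := ((A', B', C', D'), ν))
        (fun _ _ => contDiffAt_const) (fun _ _ => contDiffAt_const)
        (fun _ _ => contDiffAt_const) (fun _ _ => contDiffAt_const)
        (by fun_prop) (isUnit_shiftedMatrix hA hν)
      have h3 := h2.sub h1
      exact (h3.mul h3.conjTranspose).re_trace)
  refine ⟨(1 / (2 * Real.pi)) • L, hL.const_mul _, fun a b c d => ?_⟩
  let E : ℝ → Matrix (Fin p) (Fin m) ℂ := fun ν =>
    transferFunction A B C D ν - transferFunction A' B' C' D' ν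
  have hEc : ContinuousOn E (Icc (-ω) ω) :=
    (continuousOn_transferFunction hA B C D).sub (continuousOn_transferFunction hA' B' C' D')
  have h4 := hLD (a, b, c, d)
    (fun ν => -2 * (transferDeriv A' B' C' a b c d ν * (E ν)ᴴ).trace.re) (fun ν hν => by
      have h5 := (entrywiseHasDerivAt_transferFunction_line (isUnit_shiftedMatrix hA' hν)
        B' C' D' a b c d).const_sub (transferFunction A B C D ν)
      refine ((h5.mul h5.conjTranspose).re_trace).congr_deriv ?_
      -- The two terms of the product rule are conjugate transposes of each other, so their traces
      -- have equal real parts; this is the factor 2.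
      have h6 : (E ν * (-transferDeriv A' B' C' a b c d ν)ᴴ) =
          ((-transferDeriv A' B' C' a b c d ν) * (E ν)ᴴ)ᴴ := by
        rw [Matrix.conjTranspose_mul, Matrix.conjTranspose_conjTranspose]
      simp only [zero_smul, add_zero]
      change ((-transferDeriv A' B' C' a b c d ν) * (E ν)ᴴ +
        E ν * (-transferDeriv A' B' C' a b c d ν)ᴴ).trace.re = _
      rw [h6, Matrix.trace_add, Matrix.trace_conjTranspose, Matrix.neg_mul, Matrix.trace_neg]
      simp only [Complex.add_re, Complex.neg_re, RCLike.star_def, Complex.conj_re]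
      ring)
  change 1 / (2 * Real.pi) * L (a, b, c, d) = _
  rw [h4, intervalIntegral.integral_const_mul, trace_bandMean hω ((continuousOn_transferDeriv hA' B' C' a b c d).matrixMul
      hEc.matrixConjTranspose)]
  ring

end CostGradient

end

/-! ### The band means paired with the four directions -/

section

open Set Filter Topology MeasureTheory
open scoped Interval Matrix

section GradientFormulas

variable {n r m p : ℕ} {ω : ℝ}

theorem conjTranspose_transferFunction_sub (A : Matrix (Fin n) (Fin n) ℝ)
    (B : Matrix (Fin n) (Fin m) ℝ) (C : Matrix (Fin p) (Fin n) ℝ) (D : Matrix (Fin p) (Fin m) ℝ)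
    (A' : Matrix (Fin r) (Fin r) ℝ) (B' : Matrix (Fin r) (Fin m) ℝ)
    (C' : Matrix (Fin p) (Fin r) ℝ) (D' : Matrix (Fin p) (Fin m) ℝ) (ν : ℝ) :
    (transferFunction A B C D ν - transferFunction A' B' C' D' ν)ᴴ =
      toComplexMatrix Bᵀ * (freqResolvent A ν)ᴴ * toComplexMatrix Cᵀ
        + toComplexMatrix (D - D')ᵀ
        - toComplexMatrix B'ᵀ * (freqResolvent A' ν)ᴴ * toComplexMatrix C'ᵀ := by
  simp only [transferFunction_eq_freqResolvent, Matrix.conjTranspose_sub, Matrix.conjTranspose_add,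
    Matrix.conjTranspose_mul, conjTranspose_toComplexMatrix, Matrix.transpose_sub,
    toComplexMatrix_sub, Matrix.mul_assoc]
  abel

/-- The derivative of the cost as a pairing of the four directions with four band means. -/
theorem trace_bandMean_transferDeriv_mul (hω : 0 ≤ ω) {A : Matrix (Fin r) (Fin r) ℝ}
    (hA : A ∈ bandDomain r ω) (B : Matrix (Fin r) (Fin m) ℝ) (C : Matrix (Fin p) (Fin r) ℝ)
    {K : ℝ → Matrix (Fin m) (Fin p) ℂ} (hK : ContinuousOn K (Icc (-ω) ω))
    (a : Matrix (Fin r) (Fin r) ℝ) (b : Matrix (Fin r) (Fin m) ℝ)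
    (c : Matrix (Fin p) (Fin r) ℝ) (d : Matrix (Fin p) (Fin m) ℝ) :
    (bandMean ω fun ν => transferDeriv A B C a b c d ν * K ν).trace =
      (a * bandMean ω fun ν => freqResolvent A ν * toComplexMatrix B * K ν * toComplexMatrix C *
        freqResolvent A ν).trace
      + (b * bandMean ω fun ν => K ν * toComplexMatrix C * freqResolvent A ν).trace
      + (c * bandMean ω fun ν => freqResolvent A ν * toComplexMatrix B * K ν).trace
      + (d * bandMean ω K).trace := by
  have hR := continuousOn_freqResolvent hA
  have hc : ∀ {k l : ℕ} (M : Matrix (Fin k) (Fin l) ℝ),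
      ContinuousOn (fun _ : ℝ => toComplexMatrix M) (Icc (-ω) ω) :=
    fun M => continuousOn_toComplexMatrix_const M
  have hRBK := (hR.matrixMul (hc B)).matrixMul hK
  have hCR := (hc C).matrixMul hR
  have h1 := (hc c).matrixMul hRBK
  have h2 := hCR.matrixMul ((hc a).matrixMul hRBK)
  have h3 := hCR.matrixMul ((hc b).matrixMul hK)
  have h4 := (hc d).matrixMul hK
  -- Constants come out of a band mean only at its ends. The terms in a and b are bracketed so that
  -- cyclicity of the trace can move C R to the right and leave a or b in front.
  have hsplit : (bandMean ω fun ν => transferDeriv A B C a b c d ν * K ν) =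
      (bandMean ω fun ν => toComplexMatrix c * (freqResolvent A ν * toComplexMatrix B * K ν))
      + (bandMean ω fun ν => toComplexMatrix C * freqResolvent A ν *
        (toComplexMatrix a * (freqResolvent A ν * toComplexMatrix B * K ν)))
      + (bandMean ω fun ν => toComplexMatrix C * freqResolvent A ν * (toComplexMatrix b * K ν))
      + (bandMean ω fun ν => toComplexMatrix d * K ν) := by
    rw [← bandMean_add hω h1 h2, ← bandMean_add hω (h1.fun_add h2) h3,
      ← bandMean_add hω ((h1.fun_add h2).fun_add h3) h4]
    congr 1
    funext ν
    simp only [transferDeriv, Matrix.add_mul, Matrix.mul_assoc]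
  rw [hsplit, Matrix.trace_add, Matrix.trace_add, Matrix.trace_add,
    trace_bandMean_comm hω hCR ((hc a).matrixMul hRBK),
    trace_bandMean_comm hω hCR ((hc b).matrixMul hK), bandMean_const_mul hω c hRBK,
    bandMean_const_mul hω d hK, ← bandMean_const_mul hω a
      ((hRBK.matrixMul (hc C)).matrixMul hR),
    ← bandMean_const_mul hω b ((hK.matrixMul (hc C)).matrixMul hR)]
  simp only [Matrix.mul_assoc]
  ring

variable {A : Matrix (Fin n) (Fin n) ℝ} {B : Matrix (Fin n) (Fin m) ℝ}
  {C : Matrix (Fin p) (Fin n) ℝ} {D : Matrix (Fin p) (Fin m) ℝ}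
  {A' : Matrix (Fin r) (Fin r) ℝ} {B' : Matrix (Fin r) (Fin m) ℝ}
  {C' : Matrix (Fin p) (Fin r) ℝ} {D' : Matrix (Fin p) (Fin m) ℝ}

theorem IsHurwitz.eq_bandMean_reachability (hω : 0 ≤ ω) (hA : IsHurwitz A) (hA' : IsHurwitz A')
    {X : Matrix (Fin n) (Fin r) ℝ}
    (hX : SolvesSylvester A A'ᵀ (freqS ω A * B * B'ᵀ + B * B'ᵀ * (freqS ω A')ᵀ) X) :
    X = bandMean ω fun ν =>
      freqResolvent A ν * toComplexMatrix (B * B'ᵀ) * (freqResolvent A' ν)ᴴ := by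
  refine hA.solvesSylvester_unique hA'.transpose hX ?_
  rw [Matrix.mul_assoc (freqS ω A)]
  exact solvesSylvester_bandMean_mul_conjTranspose hω (hA.mem_bandDomain ω)
    (hA'.mem_bandDomain ω) (B * B'ᵀ)

/-- The inhomogeneity here has plus signs: for the error gradient this Y is -Y_ω, while for A = Â
and C = Ĉ it is Q̂_ω itself. -/
theorem IsHurwitz.eq_bandMean_observability (hω : 0 ≤ ω) (hA : IsHurwitz A) (hA' : IsHurwitz A')
    {Y : Matrix (Fin n) (Fin r) ℝ}
    (hY : SolvesSylvester Aᵀ A' ((freqS ω A)ᵀ * Cᵀ * C' + Cᵀ * C' * freqS ω A') Y) :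
    Y = bandMean ω fun ν =>
      (freqResolvent A ν)ᴴ * toComplexMatrix (Cᵀ * C') * freqResolvent A' ν := by
  refine hA.transpose.solvesSylvester_unique hA' hY ?_
  rw [Matrix.mul_assoc (freqS ω A)ᵀ]
  exact solvesSylvester_bandMean_conjTranspose_mul hω (hA.mem_bandDomain ω)
    (hA'.mem_bandDomain ω) (Cᵀ * C')

theorem bandMean_mul_conjTranspose_transpose {a b : ℕ} (F : ℝ → Matrix (Fin a) (Fin a) ℂ)
    (G : ℝ → Matrix (Fin b) (Fin b) ℂ) (H : Matrix (Fin a) (Fin b) ℝ) :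
    (bandMean ω fun ν => F ν * toComplexMatrix H * (G ν)ᴴ)ᵀ =
      bandMean ω fun ν => G ν * toComplexMatrix Hᵀ * (F ν)ᴴ := by
  rw [← bandMean_conjTranspose]
  congr 1
  funext ν
  simp only [Matrix.conjTranspose_mul, Matrix.conjTranspose_conjTranspose,
    conjTranspose_toComplexMatrix, Matrix.mul_assoc]

theorem bandMean_conjTranspose_mul_transpose {a b : ℕ} (F : ℝ → Matrix (Fin a) (Fin a) ℂ)
    (G : ℝ → Matrix (Fin b) (Fin b) ℂ) (H : Matrix (Fin a) (Fin b) ℝ) :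
    (bandMean ω fun ν => (F ν)ᴴ * toComplexMatrix H * G ν)ᵀ =
      bandMean ω fun ν => (G ν)ᴴ * toComplexMatrix Hᵀ * F ν := by
  rw [← bandMean_conjTranspose]
  congr 1
  funext ν
  simp only [Matrix.conjTranspose_mul, Matrix.conjTranspose_conjTranspose,
    conjTranspose_toComplexMatrix, Matrix.mul_assoc]

/-- The band mean that gives the gradient in `D̂`. -/
theorem bandMean_error (hω : 0 ≤ ω) (hA : A ∈ bandDomain n ω) (hA' : A' ∈ bandDomain r ω) :
    (bandMean ω fun ν => (transferFunction A B C D ν - transferFunction A' B' C' D' ν)ᴴ) =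
      (C * freqS ω A * B + (ω / Real.pi) • (D - D') - C' * freqS ω A' * B')ᵀ := by
  have hc : ∀ {k l : ℕ} (M : Matrix (Fin k) (Fin l) ℝ),
      ContinuousOn (fun _ : ℝ => toComplexMatrix M) (Icc (-ω) ω) :=
    fun M => continuousOn_toComplexMatrix_const M
  have hR := (continuousOn_freqResolvent hA)
  have hR' := (continuousOn_freqResolvent hA')
  have h1 := (hc C).matrixMul hR
  have h1' := (hc C').matrixMul hR'
  have h2 := h1.matrixMul (hc B)
  have h2' := h1'.matrixMul (hc B')
  rw [bandMean_conjTranspose, freqS_eq_bandMean hω hA, freqS_eq_bandMean hω hA',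
    ← bandMean_const_mul hω C hR, ← bandMean_const_mul hω C' hR', ← bandMean_mul_const hω B h1,
    ← bandMean_mul_const hω B' h1', ← bandMean_const, ← bandMean_add hω h2 (hc _),
    ← bandMean_sub hω (h2.fun_add (hc _)) h2']
  congr 2
  funext ν
  simp only [transferFunction_eq_freqResolvent, toComplexMatrix_sub]
  abel

/-- The band mean that gives the gradient in `Ĉ`. -/
theorem bandMean_freqResolvent_mul_error (hω : 0 ≤ ω) (hA : IsHurwitz A) (hA' : IsHurwitz A')
    {X : Matrix (Fin n) (Fin r) ℝ} {P : Matrix (Fin r) (Fin r) ℝ}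
    (hX : SolvesSylvester A A'ᵀ (freqS ω A * B * B'ᵀ + B * B'ᵀ * (freqS ω A')ᵀ) X)
    (hP : SolvesSylvester A' A'ᵀ (freqS ω A' * B' * B'ᵀ + B' * B'ᵀ * (freqS ω A')ᵀ) P) :
    (bandMean ω fun ν => freqResolvent A' ν * toComplexMatrix B' *
      (transferFunction A B C D ν - transferFunction A' B' C' D' ν)ᴴ) =
      (C * X + (D - D') * B'ᵀ * (freqS ω A')ᵀ - C' * P)ᵀ := by
  have hc : ∀ {k l : ℕ} (M : Matrix (Fin k) (Fin l) ℝ),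
      ContinuousOn (fun _ : ℝ => toComplexMatrix M) (Icc (-ω) ω) :=
    fun M => continuousOn_toComplexMatrix_const M
  have hR := (continuousOn_freqResolvent (hA.mem_bandDomain ω)).matrixConjTranspose
  have hR' := continuousOn_freqResolvent (hA'.mem_bandDomain ω)
  have hX' : Xᵀ = bandMean ω fun ν =>
      freqResolvent A' ν * toComplexMatrix (B' * Bᵀ) * (freqResolvent A ν)ᴴ := by
    rw [hA.eq_bandMean_reachability hω hA' hX, bandMean_mul_conjTranspose_transpose]
    simp
  have hP' : Pᵀ = bandMean ω fun ν =>
      freqResolvent A' ν * toComplexMatrix (B' * B'ᵀ) * (freqResolvent A' ν)ᴴ := by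
    rw [hA'.eq_bandMean_reachability hω hA' hP, bandMean_mul_conjTranspose_transpose]
    simp
  have h1 := (hR'.matrixMul (hc (B' * Bᵀ))).matrixMul hR
  have h2 := (hR'.matrixMul (hc (B' * B'ᵀ))).matrixMul hR'.matrixConjTranspose
  have h3 := h1.matrixMul (hc Cᵀ)
  have h4 := h2.matrixMul (hc C'ᵀ)
  have h5 := hR'.matrixMul (hc (B' * (D - D')ᵀ))
  simp only [Matrix.transpose_sub, Matrix.transpose_add, Matrix.transpose_mul,
    Matrix.transpose_transpose]
  rw [← Matrix.transpose_sub D D', hX', hP', freqS_eq_bandMean hω (hA'.mem_bandDomain ω),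
    ← bandMean_mul_const hω _ h1, ← bandMean_mul_const hω _ h2, ← bandMean_mul_const hω _ hR',
    ← bandMean_add hω h3 h5, ← bandMean_sub hω (h3.fun_add h5) h4]
  congr 1
  funext ν
  simp only [conjTranspose_transferFunction_sub, toComplexMatrix_mul, Matrix.mul_sub,
    Matrix.mul_add, Matrix.mul_assoc]

/-- The band mean that gives the gradient in `B̂`. -/
theorem bandMean_error_mul_freqResolvent (hω : 0 ≤ ω) (hA : IsHurwitz A) (hA' : IsHurwitz A')
    {Y : Matrix (Fin n) (Fin r) ℝ} {Q : Matrix (Fin r) (Fin r) ℝ}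
    (hY : SolvesSylvester Aᵀ A' ((freqS ω A)ᵀ * Cᵀ * C' + Cᵀ * C' * freqS ω A') Y)
    (hQ : SolvesSylvester A'ᵀ A' ((freqS ω A')ᵀ * C'ᵀ * C' + C'ᵀ * C' * freqS ω A') Q) :
    (bandMean ω fun ν => (transferFunction A B C D ν - transferFunction A' B' C' D' ν)ᴴ *
      toComplexMatrix C' * freqResolvent A' ν) =
      Bᵀ * Y + (D - D')ᵀ * C' * freqS ω A' - B'ᵀ * Q := by
  have hc : ∀ {k l : ℕ} (M : Matrix (Fin k) (Fin l) ℝ),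
      ContinuousOn (fun _ : ℝ => toComplexMatrix M) (Icc (-ω) ω) :=
    fun M => continuousOn_toComplexMatrix_const M
  have hR := (continuousOn_freqResolvent (hA.mem_bandDomain ω)).matrixConjTranspose
  have hR' := continuousOn_freqResolvent (hA'.mem_bandDomain ω)
  have h1 := (hR.matrixMul (hc (Cᵀ * C'))).matrixMul hR'
  have h2 := (hR'.matrixConjTranspose.matrixMul (hc (C'ᵀ * C'))).matrixMul hR'
  have h3 := (hc Bᵀ).matrixMul h1
  have h4 := (hc B'ᵀ).matrixMul h2
  have h5 := (hc ((D - D')ᵀ * C')).matrixMul hR'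
  rw [hA.eq_bandMean_observability hω hA' hY, hA'.eq_bandMean_observability hω hA' hQ,
    freqS_eq_bandMean hω (hA'.mem_bandDomain ω),
    ← bandMean_const_mul hω _ h1, ← bandMean_const_mul hω _ h2, ← bandMean_const_mul hω _ hR',
    ← bandMean_add hω h3 h5, ← bandMean_sub hω (h3.fun_add h5) h4]
  congr 1
  funext ν
  simp only [conjTranspose_transferFunction_sub, toComplexMatrix_mul, Matrix.sub_mul,
    Matrix.add_mul, Matrix.mul_assoc]

theorem gradW_eq_neg_bandMean (hω : 0 ≤ ω) (hA' : A' ∈ bandDomain r ω)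
    (V : Matrix (Fin r) (Fin r) ℝ) :
    gradW ω A' V =
      -(bandMean ω fun ν => freqResolvent A' ν * toComplexMatrix Vᵀ * freqResolvent A' ν)ᵀ := by
  rw [gradW, re_logFrechet_eq_neg_bandMean hω hA', Matrix.transpose_neg]

/-- The band mean that gives the gradient in `Â`. -/
theorem bandMean_freqResolvent_mul_error_mul_freqResolvent (hω : 0 ≤ ω) (hA : IsHurwitz A)
    (hA' : IsHurwitz A') {Y X : Matrix (Fin n) (Fin r) ℝ} {Q P : Matrix (Fin r) (Fin r) ℝ}
    (hY : SolvesSylvester Aᵀ A' ((freqS ω A)ᵀ * Cᵀ * C' + Cᵀ * C' * freqS ω A') Y)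
    (hQ : SolvesSylvester A'ᵀ A' ((freqS ω A')ᵀ * C'ᵀ * C' + C'ᵀ * C' * freqS ω A') Q)
    (hX : SolvesSylvester A A'ᵀ (B * B'ᵀ) X) (hP : SolvesSylvester A' A'ᵀ (B' * B'ᵀ) P) :
    (bandMean ω fun ν => freqResolvent A' ν * toComplexMatrix B' *
      (transferFunction A B C D ν - transferFunction A' B' C' D' ν)ᴴ *
      toComplexMatrix C' * freqResolvent A' ν) =
      Xᵀ * Y - Pᵀ * Q + (gradW ω A' (gradV C D B' C' D' X P))ᵀ := by
  have hc : ∀ {k l : ℕ} (M : Matrix (Fin k) (Fin l) ℝ),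
      ContinuousOn (fun _ : ℝ => toComplexMatrix M) (Icc (-ω) ω) :=
    fun M => continuousOn_toComplexMatrix_const M
  have hR := (continuousOn_freqResolvent (hA.mem_bandDomain ω)).matrixConjTranspose
  have hR' := continuousOn_freqResolvent (hA'.mem_bandDomain ω)
  have h1 := (hR.matrixMul (hc (Cᵀ * C'))).matrixMul hR'
  have h2 := (hR'.matrixConjTranspose.matrixMul (hc (C'ᵀ * C'))).matrixMul hR'
  have h3 := (hc Xᵀ).matrixMul h1
  have h4 := (hc Pᵀ).matrixMul h2
  have h5 := (hR'.matrixMul (hc (gradV C D B' C' D' X P)ᵀ)).matrixMul hR'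
  have hXT : SolvesSylvester A' Aᵀ (B' * Bᵀ) Xᵀ := by simpa using hX.transpose
  have hPT : SolvesSylvester A' A'ᵀ (B' * B'ᵀ) Pᵀ := by simpa using hP.transpose
  rw [gradW_eq_neg_bandMean hω (hA'.mem_bandDomain ω), Matrix.transpose_neg,
    Matrix.transpose_transpose,
    hA.eq_bandMean_observability hω hA' hY, hA'.eq_bandMean_observability hω hA' hQ,
    ← bandMean_const_mul hω _ h1, ← bandMean_const_mul hω _ h2, ← bandMean_sub hω h3 h4,
    ← sub_eq_add_neg, ← bandMean_sub hω (h3.fun_sub h4) h5]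
  refine bandMean_congr hω fun ν hν => ?_
  have hu := isUnit_shiftedMatrix (hA.mem_bandDomain ω) hν
  have hu' := isUnit_shiftedMatrix (hA'.mem_bandDomain ω) hν
  -- Here R' B̂ Bᵀ Rᴴ becomes Xᵀ Rᴴ + R' Xᵀ, and likewise with P̂. The first summands build the
  -- observability integrals of Y and Q̂; the second ones, with the D - D̂ term, add up to -R' Vᵀ
  -- R'.
  have e1 := congrArg (fun M => M * toComplexMatrix Cᵀ * toComplexMatrix C' * freqResolvent A' ν)
    (hXT.freqResolvent_mul_mul_conjTranspose hu' hu)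
  have e2 := congrArg (fun M => M * toComplexMatrix C'ᵀ * toComplexMatrix C' * freqResolvent A' ν)
    (hPT.freqResolvent_mul_mul_conjTranspose hu' hu')
  simp only [toComplexMatrix_mul, Matrix.add_mul, Matrix.mul_assoc] at e1 e2
  simp only [conjTranspose_transferFunction_sub, gradV, Matrix.transpose_sub, Matrix.transpose_mul,
    Matrix.transpose_transpose, toComplexMatrix_mul, toComplexMatrix_sub, Matrix.sub_mul,
    Matrix.add_mul, Matrix.mul_sub, Matrix.mul_add, Matrix.mul_assoc, e1, e2]
  abel

end GradientFormulas

end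

/-! ### Masked directions and partial derivatives -/

section

open Set Filter Topology MeasureTheory
open scoped Interval Matrix

section StructuredDerivatives

variable {a b : ℕ}

/-- Masking is self-adjoint for the trace pairing, which is how the factors ⊙ S reach the gradients.
-/
theorem trace_transpose_mul_hadamard (G S M : Matrix (Fin a) (Fin b) ℝ) :
    (Gᵀ * (S ⊙ M)).trace = ((G ⊙ S)ᵀ * M).trace := by
  simp only [Matrix.trace, Matrix.diag_apply, Matrix.mul_apply, Matrix.transpose_apply,
    Matrix.hadamard_apply, mul_assoc]

theorem Matrix.hadamard_sub_left (M N S : Matrix (Fin a) (Fin b) ℝ) :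
    (M - N) ⊙ S = M ⊙ S - N ⊙ S := by
  ext i j
  simp [sub_mul]

theorem trace_transpose_mul_single (G : Matrix (Fin a) (Fin b) ℝ) (i : Fin a) (j : Fin b) :
    (Gᵀ * Matrix.single i j (1 : ℝ)).trace = G i j := by
  simp [Matrix.trace_mul_single]

/-- Elementwise multiplication by a fixed matrix, as a linear map. -/
def hadamardLeft (S : Matrix (Fin a) (Fin b) ℝ) :
    Matrix (Fin a) (Fin b) ℝ →ₗ[ℝ] Matrix (Fin a) (Fin b) ℝ where
  toFun M := S ⊙ M
  map_add' M N := by ext i j; simp [mul_add]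
  map_smul' s M := by ext i j; simp [mul_left_comm]

attribute [local instance] Matrix.normedAddCommGroup Matrix.normedSpace

/-- Partial derivatives along structured directions, read off from the joint derivative. -/
theorem hasStructuredPartials_of_hasFDerivAt {H : Type*} [NormedAddCommGroup H] [NormedSpace ℝ H]
    {f : H → ℝ} {L : H →L[ℝ] ℝ} (hf : HasFDerivAt f L 0)
    (ι : Matrix (Fin a) (Fin b) ℝ →ₗ[ℝ] H) {S M G : Matrix (Fin a) (Fin b) ℝ}
    {g : Matrix (Fin a) (Fin b) ℝ → ℝ} (hg : ∀ N, f (ι N) = g (M + S ⊙ N))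
    (hL : ∀ N, L (ι N) = (Gᵀ * N).trace) : HasStructuredPartials g S M G := by
  intro i j
  have h1 : HasDerivAt (fun t : ℝ => t • ι (Matrix.single i j 1)) (ι (Matrix.single i j 1)) 0 := by
    simpa using (hasDerivAt_id (0 : ℝ)).smul_const (ι (Matrix.single i j 1))
  have hf' : HasFDerivAt f L ((0 : ℝ) • ι (Matrix.single i j 1)) := by simpa using hf
  have h2 := hf'.comp_hasDerivAt (0 : ℝ) h1
  rw [hL, trace_transpose_mul_single] at h2
  refine h2.congr_of_eventuallyEq (.of_forall fun t => ?_)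
  simp only [Function.comp_apply]
  rw [← map_smul, hg]
  simp

/-- Elementwise multiplication of four matrices by fixed matrices, as a continuous linear map. -/
noncomputable def hadamardProdLeft {r m p : ℕ} (SA : Matrix (Fin r) (Fin r) ℝ) (SB : Matrix (Fin r) (Fin m) ℝ)
    (SC : Matrix (Fin p) (Fin r) ℝ) (SD : Matrix (Fin p) (Fin m) ℝ) :
    (Matrix (Fin r) (Fin r) ℝ × Matrix (Fin r) (Fin m) ℝ ×
        Matrix (Fin p) (Fin r) ℝ × Matrix (Fin p) (Fin m) ℝ) →L[ℝ]
      (Matrix (Fin r) (Fin r) ℝ × Matrix (Fin r) (Fin m) ℝ ×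
        Matrix (Fin p) (Fin r) ℝ × Matrix (Fin p) (Fin m) ℝ) :=
  LinearMap.toContinuousLinearMap ((hadamardLeft SA).prodMap
    ((hadamardLeft SB).prodMap ((hadamardLeft SC).prodMap (hadamardLeft SD))))

theorem HasFDerivAt.comp_hadamardProdLeft {r m p : ℕ}
    {f : Matrix (Fin r) (Fin r) ℝ × Matrix (Fin r) (Fin m) ℝ ×
        Matrix (Fin p) (Fin r) ℝ × Matrix (Fin p) (Fin m) ℝ → ℝ}
    {L : (Matrix (Fin r) (Fin r) ℝ × Matrix (Fin r) (Fin m) ℝ ×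
        Matrix (Fin p) (Fin r) ℝ × Matrix (Fin p) (Fin m) ℝ) →L[ℝ] ℝ}
    {A : Matrix (Fin r) (Fin r) ℝ} {B : Matrix (Fin r) (Fin m) ℝ}
    {C : Matrix (Fin p) (Fin r) ℝ} {D : Matrix (Fin p) (Fin m) ℝ}
    (hf : HasFDerivAt f L (A, B, C, D))
    (SA : Matrix (Fin r) (Fin r) ℝ) (SB : Matrix (Fin r) (Fin m) ℝ)
    (SC : Matrix (Fin p) (Fin r) ℝ) (SD : Matrix (Fin p) (Fin m) ℝ) :
    HasFDerivAt (fun x : Matrix (Fin r) (Fin r) ℝ × Matrix (Fin r) (Fin m) ℝ ×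
        Matrix (Fin p) (Fin r) ℝ × Matrix (Fin p) (Fin m) ℝ =>
      f (A + SA ⊙ x.1, B + SB ⊙ x.2.1, C + SC ⊙ x.2.2.1, D + SD ⊙ x.2.2.2))
      (L.comp (hadamardProdLeft SA SB SC SD)) 0 := by
  have h1 : HasFDerivAt (fun x => (A, B, C, D) + hadamardProdLeft SA SB SC SD x)
      (hadamardProdLeft SA SB SC SD) 0 :=
    (hadamardProdLeft SA SB SC SD).hasFDerivAt.const_add _
  have h2 : HasFDerivAt f L ((A, B, C, D) + hadamardProdLeft SA SB SC SD 0) := by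
    simpa using hf
  exact h2.comp 0 h1

/-- Each block of partials is the joint derivative restricted along a coordinate inclusion. -/
theorem hasStructuredPartials_of_hasFDerivAt_prod {r m p : ℕ}
    {f : Matrix (Fin r) (Fin r) ℝ × Matrix (Fin r) (Fin m) ℝ ×
        Matrix (Fin p) (Fin r) ℝ × Matrix (Fin p) (Fin m) ℝ → ℝ}
    {L : (Matrix (Fin r) (Fin r) ℝ × Matrix (Fin r) (Fin m) ℝ ×
        Matrix (Fin p) (Fin r) ℝ × Matrix (Fin p) (Fin m) ℝ) →L[ℝ] ℝ}
    {A SA GA : Matrix (Fin r) (Fin r) ℝ} {B SB GB : Matrix (Fin r) (Fin m) ℝ}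
    {C SC GC : Matrix (Fin p) (Fin r) ℝ} {D SD GD : Matrix (Fin p) (Fin m) ℝ}
    (hf : HasFDerivAt (fun x : Matrix (Fin r) (Fin r) ℝ × Matrix (Fin r) (Fin m) ℝ ×
        Matrix (Fin p) (Fin r) ℝ × Matrix (Fin p) (Fin m) ℝ =>
      f (A + SA ⊙ x.1, B + SB ⊙ x.2.1, C + SC ⊙ x.2.2.1, D + SD ⊙ x.2.2.2)) L 0)
    (hL : ∀ a b c d, L (a, b, c, d) =
      (GAᵀ * a).trace + (GBᵀ * b).trace + (GCᵀ * c).trace + (GDᵀ * d).trace) :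
    HasStructuredPartials (fun M => f (M, B, C, D)) SA A GA ∧
      HasStructuredPartials (fun M => f (A, M, C, D)) SB B GB ∧
      HasStructuredPartials (fun M => f (A, B, M, D)) SC C GC ∧
      HasStructuredPartials (fun M => f (A, B, C, M)) SD D GD := by
  refine ⟨?_, ?_, ?_, ?_⟩
  · refine hasStructuredPartials_of_hasFDerivAt hf (LinearMap.inl ℝ _ _) (fun N => ?_)
      fun N => (hL N 0 0 0).trans ?_ <;> simp
  · refine hasStructuredPartials_of_hasFDerivAt hf (LinearMap.inr ℝ _ _ ∘ₗ LinearMap.inl ℝ _ _)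
      (fun N => ?_) fun N => (hL 0 N 0 0).trans ?_ <;> simp
  · refine hasStructuredPartials_of_hasFDerivAt hf
      (LinearMap.inr ℝ _ _ ∘ₗ LinearMap.inr ℝ _ _ ∘ₗ LinearMap.inl ℝ _ _)
      (fun N => ?_) fun N => (hL 0 0 N 0).trans ?_ <;> simp
  · refine hasStructuredPartials_of_hasFDerivAt hf
      (LinearMap.inr ℝ _ _ ∘ₗ LinearMap.inr ℝ _ _ ∘ₗ LinearMap.inr ℝ _ _)
      (fun N => ?_) fun N => (hL 0 0 0 N).trans ?_ <;> simp

end StructuredDerivatives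

end

/-! ### Assembly of the theorem -/

theorem mainTheorem1 {n r m p : ℕ} (ω : ℝ) (hω : 0 < ω)
    (A : Matrix (Fin n) (Fin n) ℝ) (B : Matrix (Fin n) (Fin m) ℝ)
    (C : Matrix (Fin p) (Fin n) ℝ) (D : Matrix (Fin p) (Fin m) ℝ)
    (A' : Matrix (Fin r) (Fin r) ℝ) (B' : Matrix (Fin r) (Fin m) ℝ)
    (C' : Matrix (Fin p) (Fin r) ℝ) (D' : Matrix (Fin p) (Fin m) ℝ)
    (hA : IsHurwitz A) (hA' : IsHurwitz A')
    (SA : Matrix (Fin r) (Fin r) ℝ) (SB : Matrix (Fin r) (Fin m) ℝ)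
    (SC : Matrix (Fin p) (Fin r) ℝ) (SD : Matrix (Fin p) (Fin m) ℝ)
    (hSA : IsStructureMatrix SA) (hSB : IsStructureMatrix SB)
    (hSC : IsStructureMatrix SC) (hSD : IsStructureMatrix SD) :
    -- the logarithms exist, and the logarithm is differentiable where its derivative is taken
    IsPrincipalLog (negShift ω A) (matrixLog (negShift ω A)) ∧
    IsPrincipalLog (negShift ω A') (matrixLog (negShift ω A')) ∧
    DifferentiableAt ℂ (matrixLog (n := r)) (negShift ω A') ∧
    -- the six Lyapunov and Sylvester equations have exactly one solution each
    (∃! Xω, SolvesSylvester A A'ᵀ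
      (freqS ω A * B * B'ᵀ + B * B'ᵀ * (freqS ω A')ᵀ) Xω) ∧
    (∃! Pω', SolvesSylvester A' A'ᵀ
      (freqS ω A' * B' * B'ᵀ + B' * B'ᵀ * (freqS ω A')ᵀ) Pω') ∧
    (∃! Yω, SolvesSylvester Aᵀ A'
      (-((freqS ω A)ᵀ * Cᵀ * C') - Cᵀ * C' * freqS ω A') Yω) ∧
    (∃! Qω', SolvesSylvester A'ᵀ A'
      ((freqS ω A')ᵀ * C'ᵀ * C' + C'ᵀ * C' * freqS ω A') Qω') ∧
    (∃! X, SolvesSylvester A A'ᵀ (B * B'ᵀ) X) ∧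
    (∃! P', SolvesSylvester A' A'ᵀ (B' * B'ᵀ) P') ∧
    -- the gradient
    ∀ (Xω : Matrix (Fin n) (Fin r) ℝ) (Pω' : Matrix (Fin r) (Fin r) ℝ)
      (Yω : Matrix (Fin n) (Fin r) ℝ) (Qω' : Matrix (Fin r) (Fin r) ℝ)
      (X : Matrix (Fin n) (Fin r) ℝ) (P' : Matrix (Fin r) (Fin r) ℝ),
      SolvesSylvester A A'ᵀ (freqS ω A * B * B'ᵀ + B * B'ᵀ * (freqS ω A')ᵀ) Xω →
      SolvesSylvester A' A'ᵀ (freqS ω A' * B' * B'ᵀ + B' * B'ᵀ * (freqS ω A')ᵀ) Pω' →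
      SolvesSylvester Aᵀ A' (-((freqS ω A)ᵀ * Cᵀ * C') - Cᵀ * C' * freqS ω A') Yω →
      SolvesSylvester A'ᵀ A' ((freqS ω A')ᵀ * C'ᵀ * C' + C'ᵀ * C' * freqS ω A') Qω' →
      SolvesSylvester A A'ᵀ (B * B'ᵀ) X →
      SolvesSylvester A' A'ᵀ (B' * B'ᵀ) P' →
      ∀ (GA : Matrix (Fin r) (Fin r) ℝ) (GB : Matrix (Fin r) (Fin m) ℝ)
        (GC : Matrix (Fin p) (Fin r) ℝ) (GD : Matrix (Fin p) (Fin m) ℝ),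
        GA = (2 : ℝ) • ((Yωᵀ * X + Qω' * P') ⊙ SA)
          - (2 : ℝ) • (gradW ω A' (gradV C D B' C' D' X P') ⊙ SA) →
        GB = (2 : ℝ) • ((Qω' * B' + Yωᵀ * B - (freqS ω A')ᵀ * C'ᵀ * (D - D')) ⊙ SB) →
        GC = (2 : ℝ) • ((C' * Pω' - C * Xω - (D - D') * B'ᵀ * (freqS ω A')ᵀ) ⊙ SC) →
        GD = (-2 : ℝ) • ((C * freqS ω A * B + (ω / (2 * Real.pi)) • D
          - C' * freqS ω A' * B' - (ω / (2 * Real.pi)) • D'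
          + (ω / (2 * Real.pi)) • (D - D')) ⊙ SD) →
        HasStructuredPartials (fun M => errorCost ω A B C D M B' C' D') SA A' GA ∧
        HasStructuredPartials (fun M => errorCost ω A B C D A' M C' D') SB B' GB ∧
        HasStructuredPartials (fun M => errorCost ω A B C D A' B' M D') SC C' GC ∧
        HasStructuredPartials (fun M => errorCost ω A B C D A' B' C' M) SD D' GD ∧
        -- joint differentiability in all free entries, with the same gradient
        ∃ L : (Matrix (Fin r) (Fin r) ℝ × Matrix (Fin r) (Fin m) ℝ ×
            Matrix (Fin p) (Fin r) ℝ × Matrix (Fin p) (Fin m) ℝ) →L[ℝ] ℝ,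
          (∀ a b c d, L (a, b, c, d) =
            (GAᵀ * a).trace + (GBᵀ * b).trace + (GCᵀ * c).trace + (GDᵀ * d).trace) ∧
          HasFDerivAt (fun x : Matrix (Fin r) (Fin r) ℝ × Matrix (Fin r) (Fin m) ℝ ×
              Matrix (Fin p) (Fin r) ℝ × Matrix (Fin p) (Fin m) ℝ =>
            errorCost ω A B C D (A' + SA ⊙ x.1) (B' + SB ⊙ x.2.1)
              (C' + SC ⊙ x.2.2.1) (D' + SD ⊙ x.2.2.2)) L 0 := by
  have hω' := hω.le
  have hAd := hA.mem_bandDomain ω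
  have hAd' := hA'.mem_bandDomain ω
  refine ⟨isPrincipalLog_matrixLog (negShift_mem_logDomain hω' hAd),
    isPrincipalLog_matrixLog (negShift_mem_logDomain hω' hAd'),
    differentiableAt_matrixLog (negShift_mem_logDomain hω' hAd'),
    hA.existsUnique_solvesSylvester hA'.transpose _,
    hA'.existsUnique_solvesSylvester hA'.transpose _,
    hA.transpose.existsUnique_solvesSylvester hA' _,
    hA'.transpose.existsUnique_solvesSylvester hA' _,
    hA.existsUnique_solvesSylvester hA'.transpose _,
    hA'.existsUnique_solvesSylvester hA'.transpose _, ?_⟩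
  intro Xω Pω' Yω Qω' X P' hXω hPω hYω hQω hX hP GA GB GC GD hGA hGB hGC hGD
  have hY : SolvesSylvester Aᵀ A' ((freqS ω A)ᵀ * Cᵀ * C' + Cᵀ * C' * freqS ω A') (-Yω) := by
    have h1 : Aᵀ * Yω + Yω * A' + (-((freqS ω A)ᵀ * Cᵀ * C') - Cᵀ * C' * freqS ω A') = 0 := hYω
    change Aᵀ * -Yω + -Yω * A' + ((freqS ω A)ᵀ * Cᵀ * C' + Cᵀ * C' * freqS ω A') = 0
    rw [← neg_eq_zero, ← h1, Matrix.mul_neg, Matrix.neg_mul]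
    abel
  -- The gradients in Â and B̂ come out transposed, with Q̂_ω on the other side; symmetry is visible
  -- from the integral formula.
  have hQsymm : Qω'ᵀ = Qω' := by
    rw [hA'.eq_bandMean_observability hω' hA' hQω, bandMean_conjTranspose_mul_transpose]
    simp
  obtain ⟨L, hL, hLf⟩ := exists_hasFDerivAt_errorCost hω' hAd B C D hAd' B' C' D'
  have hEc := ((continuousOn_transferFunction hAd B C D).sub
    (continuousOn_transferFunction hAd' B' C' D')).matrixConjTranspose
  have hLtr : ∀ a b c d, L (SA ⊙ a, SB ⊙ b, SC ⊙ c, SD ⊙ d) =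
      (GAᵀ * a).trace + (GBᵀ * b).trace + (GCᵀ * c).trace + (GDᵀ * d).trace := by
    intro a b c d
    -- Reduces each of the four blocks to one identity: the transpose of the unmasked gradient M is
    -- -2 times the band mean T paired with that direction.
    have hpair : ∀ {k l : ℕ} (M G : Matrix (Fin k) (Fin l) ℝ) (N S : Matrix (Fin k) (Fin l) ℝ)
        (T : Matrix (Fin l) (Fin k) ℝ), G = M ⊙ S → Mᵀ = (-2 : ℝ) • T →
        -2 * ((S ⊙ N) * T).trace = (Gᵀ * N).trace := by
      rintro k l M G N S T rfl hM
      rw [← trace_transpose_mul_hadamard, hM, Matrix.smul_mul, Matrix.trace_smul,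
        Matrix.trace_mul_comm, smul_eq_mul]
    rw [hLf]
    have hE := trace_bandMean_transferDeriv_mul hω' hAd' B' C' hEc (SA ⊙ a) (SB ⊙ b) (SC ⊙ c)
      (SD ⊙ d)
    refine (congrArg (fun x : ℝ => -2 * x) hE).trans ?_
    simp only [mul_add]
    congr 1
    · congr 1
      · congr 1
        · refine hpair ((2 : ℝ) • (Yωᵀ * X + Qω' * P')
            - (2 : ℝ) • gradW ω A' (gradV C D B' C' D' X P')) _ _ _ _ ?_ ?_
          · rw [hGA, Matrix.hadamard_sub_left, Matrix.smul_hadamard, Matrix.smul_hadamard]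
          · have h1 := bandMean_freqResolvent_mul_error_mul_freqResolvent (D := D) (D' := D') hω'
              hA hA' hY hQω hX hP
            refine Eq.trans ?_ (congrArg (fun M => (-2 : ℝ) • M) h1.symm)
            simp only [Matrix.transpose_sub, Matrix.transpose_smul, Matrix.transpose_add,
              Matrix.transpose_mul, Matrix.transpose_transpose, hQsymm, Matrix.mul_neg]
            module
        · refine hpair ((2 : ℝ) • (Qω' * B' + Yωᵀ * B - (freqS ω A')ᵀ * C'ᵀ * (D - D')))
            _ _ _ _ ?_ ?_
          · rw [hGB, Matrix.smul_hadamard]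
          · have h1 := bandMean_error_mul_freqResolvent (B := B) (D := D) (B' := B') (D' := D') hω'
              hA hA' hY hQω
            refine Eq.trans ?_ (congrArg (fun M => (-2 : ℝ) • M) h1.symm)
            simp only [Matrix.transpose_sub, Matrix.transpose_smul, Matrix.transpose_add,
              Matrix.transpose_mul, Matrix.transpose_transpose, hQsymm, Matrix.mul_neg,
              Matrix.mul_assoc]
            module
      · refine hpair ((2 : ℝ) • (C' * Pω' - C * Xω - (D - D') * B'ᵀ * (freqS ω A')ᵀ))
          _ _ _ _ ?_ ?_
        · rw [hGC, Matrix.smul_hadamard]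
        · have h1 := bandMean_freqResolvent_mul_error (C := C) (D := D) (C' := C') (D' := D') hω'
            hA hA' hXω hPω
          refine Eq.trans ?_ (congrArg (fun M => (-2 : ℝ) • M) h1.symm)
          rw [Matrix.transpose_smul, ← Matrix.transpose_smul, ← Matrix.transpose_smul]
          congr 1
          module
    · refine hpair ((-2 : ℝ) • (C * freqS ω A * B + (ω / (2 * Real.pi)) • D
          - C' * freqS ω A' * B' - (ω / (2 * Real.pi)) • D'
          + (ω / (2 * Real.pi)) • (D - D'))) _ _ _ _ ?_ ?_
      · rw [hGD, Matrix.smul_hadamard]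
      · have h1 := bandMean_error (B := B) (C := C) (D := D) (B' := B') (C' := C') (D' := D') hω'
          hAd hAd'
        refine Eq.trans ?_ (congrArg (fun M => (-2 : ℝ) • M) h1.symm)
        rw [Matrix.transpose_smul]
        congr 2
        -- A constant has band mean ω/π times itself (length 2ω over 2π); the stated gradient writes
        -- this as two equal contributions ω/(2π).
        have h2 : ω / Real.pi = 2 * (ω / (2 * Real.pi)) := by field_simp
        rw [h2]
        module
  have hM := hL.comp_hadamardProdLeft SA SB SC SD
  obtain ⟨h1, h2, h3, h4⟩ := hasStructuredPartials_of_hasFDerivAt_prod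
    (f := fun y => errorCost ω A B C D y.1 y.2.1 y.2.2.1 y.2.2.2) hM (by exact hLtr)
  exact ⟨h1, h2, h3, h4, _, hLtr, hM⟩
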